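/- Consider $M$ operators whose base stations (BSs) are co-located. The sites form a homogeneous Poisson point process $\Phi=\{\mathbf x_j\}$ in $\mathbb R^2$ of density $\lambda>0$, and each site hosts one BS of every operator. A typical user of operator $n$ is at the origin; put $x_j=\|\mathbf x_j\|$. Given $\Phi$, the sites independently have link type $s_j\in\{\mathrm L,\mathrm N\}$ (LOS or NLOS, common to all BSs of the site) with probabilities $p_{\mathrm L}(x_j)=e^{-\beta x_j}$ and $p_{\mathrm N}(x_j)=1-e^{-\beta x_j}$, where $\beta\ge 0$. The path loss of a link of type $p$ and length $y$ is $C_p\,y^{-\alpha_p}$, with $C_p,\alpha_p>0$. Operator $m$ transmits with power $P_m>0$. The fadings $h_{mj}$ are i.i.d. exponential with mean $1$, the antenna angles $\theta_{mj}$ are i.i.d. uniform on $(-\pi,\pi)$, and fadings, angles and (sites, link types) are independent. The antenna gain is $G(\theta)=G_1$ if $|\theta|<\theta_{\mathrm b}$ and $G(\theta)=G_2$ otherwise, with $G_1,G_2\ge 0$ and $0\le\theta_{\mathrm b}\le\pi$. Let $Q_n\ni n$ be the set of operators sharing the spectrum of operator $n$ (all operators, $Q_n=\{1,\dots,M\}$,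 under full license sharing). With closed access the user associates with the BS of operator $n$ of highest average received power $P_nC_{s_i}x_i^{-\alpha_{s_i}}$; almost surely there is exactly one such site $i$. Let $s=s_i$ and $x=x_i$ be its type and distance, and let the interference be $$I=x^{-\alpha_s}C_s\sum_{m\in Q_n\setminus\{n\}}P_mh_{mi}G(\theta_{mi})+\sum_{p\in\{\mathrm L,\mathrm N\}}\ \sum_{j\ne i:\,s_j=p}x_j^{-\alpha_p}C_p\sum_{m\in Q_n}P_mh_{mj}G(\theta_{mj})\in[0,\infty].$$ Then for every $t\ge 0$, the Laplace transform $\mathcal L_I(t)=\mathbb E[e^{-tI}\mid s,x]$ of the interference to a user associated with a BS of type $s$ at distance $x$ is almost surely given by $$\mathcal L_I(t)=\prod_{m\in Q_n\setminus\{n\}}\left(\frac{\theta_{\mathrm b}/\pi}{1+tx^{-\alpha_s}C_sP_mG_1}+\frac{(\pi-\theta_{\mathrm b})/\pi}{1+tx^{-\alpha_s}C_sP_mG_2}\right)$$ $$\times\prod_{p\in\{\mathrm L,\mathrm N\}}\exp\left(-2\pi\lambda\int_{D^s_p(x)}^\infty p_p(y)\left(1-\prod_{m\in Q_n}\left(\frac{\theta_{\mathrm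 b}/\pi}{1+ty^{-\alpha_p}C_pP_mG_1}+\frac{(\pi-\theta_{\mathrm b})/\pi}{1+ty^{-\alpha_p}C_pP_mG_2}\right)\right)y\,\mathrm dy\right),$$ where $D^s_p(x)=(C_p/C_s)^{1/\alpha_p}\,x^{\alpha_s/\alpha_p}$ is the exclusion radius, the integrals take values in $[0,\infty]$, $e^{-\infty}=0$, and $0\cdot\infty=0$ in $tI$ when $t=0$. -/

import Mathlib

open MeasureTheory ProbabilityTheory
open scoped ENNReal

noncomputable section

/-- The type of a link: line-of-sight or non-line-of-sight. -/
inductive LinkType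
  | los
  | nlos
  deriving DecidableEq

instance : Fintype LinkType := ⟨{LinkType.los, LinkType.nlos}, fun p => by cases p <;> decide⟩

instance : MeasurableSpace LinkType := ⊤

/-- The plane in which the sites lie; the typical user sits at the origin. -/
abbrev Plane : Type := EuclideanSpace ℝ (Fin 2)

/-- `exp (-u)` for an extended nonnegative real `u`, with `exp (-∞) = 0`. -/
def expNeg (u : ℝ≥0∞) : ℝ := if u = ∞ then 0 else Real.exp (-u.toReal)

/-- The number of indices `j` with `X j ω ∈ A`. -/
def siteCount {Ω : Type*} (X : ℕ → Ω → Plane) (A : Set Plane) (ω : Ω) : ℝ≥0∞ :=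
  ∑' j, A.indicator 1 (X j ω)

/-- The points `X 0, X 1, …` enumerate a Poisson point process with intensity measure `ν`: the
number of points in a set of finite intensity is a Poisson variable, and the numbers of points in
disjoint sets are independent. -/
structure IsPoissonPointProcess {Ω : Type*} [MeasurableSpace Ω] (μ : Measure Ω)
    (X : ℕ → Ω → Plane) (ν : Measure Plane) : Prop where
  measurable_point : ∀ j, Measurable (X j)
  count_law : ∀ A : Set Plane, MeasurableSet A → ν A ≠ ∞ →
    μ.map (siteCount X A) = (poissonMeasure (ν A).toNNReal).map (fun k : ℕ => (k : ℝ≥0∞))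
  count_indep : ∀ (r : ℕ) (A : Fin r → Set Plane), (∀ i, MeasurableSet (A i)) →
    (∀ i, ν (A i) ≠ ∞) → Pairwise (fun i i' => Disjoint (A i) (A i')) →
    iIndepFun (fun i => siteCount X (A i)) μ

/-- The deterministic parameters of a system of `M` operators sharing their sites. -/
structure NetworkParams (M : ℕ) where
  /-- density of the sites -/
  lam : ℝ
  /-- blocking parameter -/
  beta : ℝ
  /-- path-loss gain of each link type -/
  C : LinkType → ℝ
  /-- path-loss exponent of each link type -/
  alpha : LinkType → ℝ
  /-- transmit power of each operator -/
  P : Fin M → ℝ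
  /-- main lobe gain -/
  G1 : ℝ
  /-- side lobe gain -/
  G2 : ℝ
  /-- half beamwidth -/
  thetab : ℝ
  lam_pos : 0 < lam
  beta_nonneg : 0 ≤ beta
  C_pos : ∀ p, 0 < C p
  alpha_pos : ∀ p, 0 < alpha p
  P_pos : ∀ m, 0 < P m
  G1_nonneg : 0 ≤ G1
  G2_nonneg : 0 ≤ G2
  thetab_nonneg : 0 ≤ thetab
  thetab_le_pi : thetab ≤ Real.pi

namespace NetworkParams

variable {M : ℕ} (N : NetworkParams M)

/-- The probability that a link of length `y` has type `p`. -/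
def linkProb : LinkType → ℝ → ℝ
  | .los, y => Real.exp (-N.beta * y)
  | .nlos, y => 1 - Real.exp (-N.beta * y)

/-- The path loss of a link of type `p` and length `y`. -/
def pathLoss (p : LinkType) (y : ℝ) : ℝ := N.C p * y ^ (-N.alpha p)

/-- The antenna pattern. -/
def gain (θ : ℝ) : ℝ := if |θ| < N.thetab then N.G1 else N.G2

/-- The exclusion radius for sites of link type `p`, when the serving site has link type `s` and
distance `x`. -/
def exclusionRadius (s p : LinkType) (x : ℝ) : ℝ :=
  (N.C p / N.C s) ^ (1 / N.alpha p) * x ^ (N.alpha s / N.alpha p)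

/-- The factor contributed at `t` by an interferer of operator `m`, link type `p`,
distance `y`. -/
def mixture (t : ℝ) (p : LinkType) (m : Fin M) (y : ℝ) : ℝ :=
  (N.thetab / Real.pi) / (1 + t * y ^ (-N.alpha p) * N.C p * N.P m * N.G1)
    + ((Real.pi - N.thetab) / Real.pi) / (1 + t * y ^ (-N.alpha p) * N.C p * N.P m * N.G2)

/-- The Laplace transform at `t` of the interference from the operators in `Q` to a user of
operator `n` whose serving site has link type `s` and distance `x`. The integrals have
nonnegative integrands and are taken in `[0, ∞]`. -/
def laplaceFormula (Q : Finset (Fin M)) (n : Fin M) (t : ℝ) (s : LinkType) (x : ℝ) : ℝ :=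
  (∏ m ∈ Q.erase n, N.mixture t s m x) *
    ∏ p : LinkType, expNeg (ENNReal.ofReal (2 * Real.pi * N.lam) *
      ∫⁻ y in Set.Ioi (N.exclusionRadius s p x),
        ENNReal.ofReal (N.linkProb p y * (1 - ∏ m ∈ Q, N.mixture t p m y) * y))

/-- The random elements of the system: `X j` is the location of the `j`-th site, `s j` the common
type of the links from that site to the typical user, `h m j` the fading and `θ m j` the antenna
angle of the base station of operator `m` at that site. -/
structure IsColocated {Ω : Type*} [MeasurableSpace Ω] (μ : Measure Ω)
    (X : ℕ → Ω → Plane) (s : ℕ → Ω → LinkType) (h θ : Fin M → ℕ → Ω → ℝ) : Prop where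
  /-- The sites form a homogeneous Poisson point process of density `lam`. -/
  sites : IsPoissonPointProcess μ X (ENNReal.ofReal N.lam • volume)
  measurable_type : ∀ j, Measurable (s j)
  /-- Given the sites, the link types are independent, with probabilities given by the
  distances. -/
  types_law : ∀ (J : Finset ℕ) (τ : ℕ → LinkType) (B : Set (ℕ → Plane)), MeasurableSet B →
    μ {ω | (fun j => X j ω) ∈ B ∧ ∀ j ∈ J, s j ω = τ j} =
      ∫⁻ ω in {ω | (fun j => X j ω) ∈ B}, ∏ j ∈ J, ENNReal.ofReal (N.linkProb (τ j) ‖X j ω‖) ∂μ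
  measurable_fading : ∀ m j, Measurable (h m j)
  fading_law : ∀ m j, μ.map (h m j) = expMeasure 1
  fading_indep : iIndepFun (fun mj : Fin M × ℕ => h mj.1 mj.2) μ
  measurable_angle : ∀ m j, Measurable (θ m j)
  angle_law : ∀ m j, pdf.IsUniform (θ m j) (Set.Ioo (-Real.pi) Real.pi) μ volume
  angle_indep : iIndepFun (fun mj : Fin M × ℕ => θ mj.1 mj.2) μ
  fading_indep_angle : IndepFun (fun ω (mj : Fin M × ℕ) => h mj.1 mj.2 ω)
    (fun ω (mj : Fin M × ℕ) => θ mj.1 mj.2 ω) μ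
  sites_indep_marks : IndepFun (fun ω (j : ℕ) => (X j ω, s j ω))
    (fun ω (mj : Fin M × ℕ) => (h mj.1 mj.2 ω, θ mj.1 mj.2 ω)) μ

section Association

variable {Ω : Type*} (X : ℕ → Ω → Plane) (s : ℕ → Ω → LinkType) (h θ : Fin M → ℕ → Ω → ℝ)

/-- Average power received by the typical user from the base station of operator `m` at the
`j`-th site, without antenna gain. -/
def avgPower (m : Fin M) (j : ℕ) (ω : Ω) : ℝ := N.P m * N.pathLoss (s j ω) ‖X j ω‖

/-- With closed access, a user of operator `n` associates with the base station of operator `n`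
at site `i` when it provides a larger average received power than every other base station of
operator `n`. -/
def IsServing (n : Fin M) (i : ℕ) (ω : Ω) : Prop :=
  ∀ j, j ≠ i → N.avgPower X s n j ω < N.avgPower X s n i ω

/-- The index of the serving site (`0` if there is none). -/
def servingIndex (n : Fin M) (ω : Ω) : ℕ := sInf {i | N.IsServing X s n i ω}

/-- The link type of the serving site. -/
def servingType (n : Fin M) (ω : Ω) : LinkType := s (N.servingIndex X s n ω) ω

/-- The distance of the serving site. -/
def servingDist (n : Fin M) (ω : Ω) : ℝ := ‖X (N.servingIndex X s n ω) ω‖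

/-- The interference to the typical user from all base stations of the operators in `Q`, except
the serving one: first the other base stations at the serving site, then all other sites. It is
valued in `[0, ∞]` since for small path-loss exponents the series can diverge. -/
def interference (Q : Finset (Fin M)) (n : Fin M) (ω : Ω) : ℝ≥0∞ :=
  let i := N.servingIndex X s n ω
  ENNReal.ofReal (N.pathLoss (s i ω) ‖X i ω‖ *
      ∑ m ∈ Q.erase n, N.P m * h m i ω * N.gain (θ m i ω))
    + ∑' j, if j = i then 0 else
        ENNReal.ofReal (N.pathLoss (s j ω) ‖X j ω‖ *
          ∑ m ∈ Q, N.P m * h m j ω * N.gain (θ m j ω))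

end Association

end NetworkParams

end

/-! The conditional expectation is identified by integrating `exp (-tI)` over events `{(type,
distance) ∈ B}` of the serving site. Fadings and angles are independent of the sites and types, so
integrating them out replaces each interferer by its mixture factor. This leaves the product `W` of
the factors `γ_p(y) = ∏ m ∈ Q, mixture` over all sites, divided by the single factor of the serving
base station, which does not interfere. Since `W` is a symmetric functional of all sites, no Palm
calculus is needed.

The probability generating functional (`IsColocated.lintegral_iInf_prod`) evaluates integrals of
such products. A void indicator is again a product over sites, so the functional also gives the
`W`-weighted void probabilities (`setLIntegral_weight_void`). They factor over the two types, hence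
under the weighted measure the nearest distances of the two types have law `A` times a product of
minimum laws with intensities `γ_p · intensity p`, where `A = exp (-∑ ∫ (1 - γ))` (`map_nearest`).
Almost surely these two distances determine the serving type and distance (`IsRegular.serving_iff`),
which gives their weighted law (`lintegral_serving_weight`).

The same formula with `γ = 1` is the unweighted law. Total void exponents match through `∫ (1 - γ) +
∫_{y < D} γ = ∫_{y ≥ D} (1 - γ) + ∫_{y < D} 1`, so weighting by `W` amounts to inserting the serving
site's factor and `exp (-∫_{y ≥ D} (1 - γ))` for each type (`lintegral_serving_weight_eq`). This is
the claimed formula.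

All integrals are taken in `[0, ∞]` with `exp (-∞) = 0`, so divergent interference and `A = 0` need
no separate treatment. Infinite products of factors in `[0, 1]` appear as infima of finite products.
-/

/-! ### The exponential of a negative extended real. -/

/-- `exp (-u)` for an extended nonnegative real `u`, as an extended nonnegative real. -/
noncomputable def enegexp (u : ℝ≥0∞) : ℝ≥0∞ := EReal.exp (-(u : EReal))

lemma enegexp_zero : enegexp 0 = 1 := by simp [enegexp]

lemma enegexp_top : enegexp ∞ = 0 := by simp [enegexp]

lemma enegexp_add (a b : ℝ≥0∞) : enegexp (a + b) = enegexp a * enegexp b := by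
  rw [enegexp, enegexp, enegexp, ← EReal.exp_add, EReal.coe_ennreal_add, EReal.neg_add, sub_eq_add_neg]
  · left; simp
  · right; simp

lemma enegexp_sum {ι : Type*} (F : Finset ι) (a : ι → ℝ≥0∞) :
    enegexp (∑ i ∈ F, a i) = ∏ i ∈ F, enegexp (a i) := by
  classical
  induction F using Finset.induction_on with
  | empty => simp [enegexp_zero]
  | insert i F hi ih => rw [Finset.sum_insert hi, Finset.prod_insert hi, enegexp_add, ih]

lemma enegexp_antitone : Antitone enegexp := fun a b hab => by
  apply EReal.exp_monotone
  rw [EReal.neg_le_neg_iff]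
  exact EReal.coe_ennreal_le_coe_ennreal_iff.2 hab

lemma continuous_enegexp : Continuous enegexp :=
  ENNReal.continuous_exp.comp (continuous_neg.comp continuous_coe_ennreal_ereal)

@[fun_prop]
lemma measurable_enegexp : Measurable enegexp := continuous_enegexp.measurable

lemma enegexp_le_one (u : ℝ≥0∞) : enegexp u ≤ 1 := by
  rw [← enegexp_zero]; exact enegexp_antitone zero_le

lemma enegexp_ne_top (u : ℝ≥0∞) : enegexp u ≠ ∞ :=
  ((enegexp_le_one u).trans_lt ENNReal.one_lt_top).ne

lemma enegexp_coe (u : NNReal) : enegexp u = ENNReal.ofReal (Real.exp (-u)) := by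
  have : (-((u : ℝ≥0∞) : EReal)) = ((-(u : ℝ) : ℝ) : EReal) := by
    rw [EReal.coe_neg]; rfl
  rw [enegexp, this, EReal.exp_coe]

lemma enegexp_ofReal {r : ℝ} (hr : 0 ≤ r) :
    enegexp (ENNReal.ofReal r) = ENNReal.ofReal (Real.exp (-r)) := by
  rw [ENNReal.ofReal, enegexp_coe, Real.coe_toNNReal _ hr]

lemma enegexp_of_ne_top {u : ℝ≥0∞} (hu : u ≠ ∞) :
    enegexp u = ENNReal.ofReal (Real.exp (-u.toReal)) := by
  rw [← enegexp_ofReal ENNReal.toReal_nonneg, ENNReal.ofReal_toReal hu]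

lemma ofReal_expNeg (u : ℝ≥0∞) : ENNReal.ofReal (expNeg u) = enegexp u := by
  unfold expNeg
  split_ifs with h
  · simp [h, enegexp_top]
  · rw [enegexp_of_ne_top h]

lemma expNeg_eq_toReal (u : ℝ≥0∞) : expNeg u = (enegexp u).toReal := by
  rw [← ofReal_expNeg, ENNReal.toReal_ofReal]
  unfold expNeg
  split_ifs <;> positivity

lemma measurable_expNeg : Measurable expNeg := by
  have : expNeg = fun u => (enegexp u).toReal := funext expNeg_eq_toReal
  rw [this]
  exact measurable_enegexp.ennreal_toReal

/-- Continuity and antitonicity turn the limit of partial sums into an infimum; this is how infinite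
products over sites enter. -/
lemma enegexp_tsum (a : ℕ → ℝ≥0∞) :
    enegexp (∑' j, a j) = ⨅ n, ∏ j ∈ Finset.range n, enegexp (a j) := by
  have h1 := (continuous_enegexp.tendsto _).comp (ENNReal.tendsto_nat_tsum a)
  have h2 : Antitone fun n => enegexp (∑ j ∈ Finset.range n, a j) := fun m n hmn =>
    enegexp_antitone (Finset.sum_le_sum_of_subset (Finset.range_mono hmn))
  simp_rw [← enegexp_sum]
  exact tendsto_nhds_unique h1 (tendsto_atTop_iInf h2)

/-- The inverse of `enegexp` on `[0, 1]`. -/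
noncomputable def eneglog (w : ℝ≥0∞) : ℝ≥0∞ := (-(ENNReal.log w)).toENNReal

@[fun_prop]
lemma measurable_eneglog : Measurable eneglog :=
  measurable_ereal_toENNReal.comp (continuous_neg.measurable.comp ENNReal.measurable_log)

lemma enegexp_eneglog {w : ℝ≥0∞} (hw : w ≤ 1) : enegexp (eneglog w) = w := by
  rw [enegexp, eneglog, EReal.coe_toENNReal, neg_neg, ENNReal.exp_log]
  rw [EReal.neg_nonneg]
  simpa using hw

/-- Supplies the monotone limit of the integrand `1 - exp (-u)` in the exponent of the Laplace
functional. -/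
lemma one_sub_enegexp_iSup {u : ℕ → ℝ≥0∞} (hu : Monotone u) :
    1 - enegexp (⨆ n, u n) = ⨆ n, (1 - enegexp (u n)) := by
  have h1 := (continuous_enegexp.tendsto _).comp (tendsto_atTop_iSup hu)
  have h2 := ENNReal.Tendsto.sub (tendsto_const_nhds (x := (1 : ℝ≥0∞))) h1 (Or.inl ENNReal.one_ne_top)
  refine tendsto_nhds_unique h2 (tendsto_atTop_iSup fun m n hmn => ?_)
  exact tsub_le_tsub_left (enegexp_antitone (hu hmn)) _

/-! ### Laplace and generating functionals of a Poisson process. -/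

/-- The exponential series sums `exp (-v) * (v * exp (-c)) ^ k / k!` to `exp (-v * (1 - exp (-c)))`.
-/
lemma lintegral_enegexp_poissonMeasure (v c : NNReal) :
    ∫⁻ k : ℕ, enegexp (c * (k : ℝ≥0∞)) ∂(poissonMeasure v)
      = enegexp (v * (1 - enegexp c)) := by
  have h1 : ∀ k : ℕ, enegexp (c * (k : ℝ≥0∞)) = ENNReal.ofReal (Real.exp (-c) ^ k) := fun k => by
    have : (c * (k : ℝ≥0∞)) = ((c * k : NNReal) : ℝ≥0∞) := by push_cast; rfl
    rw [this, enegexp_coe, ← Real.exp_nat_mul]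
    congr 2
    push_cast; ring
  have h2 : (v * (1 - enegexp c) : ℝ≥0∞) = ENNReal.ofReal ((v : ℝ) * (1 - Real.exp (-c))) := by
    rw [enegexp_coe, ENNReal.ofReal_mul v.coe_nonneg, ENNReal.ofReal_sub _ (Real.exp_pos _).le,
      ENNReal.ofReal_one, ENNReal.ofReal_coe_nnreal]
  have h3 : Real.exp (-c) ≤ 1 := by
    rw [Real.exp_le_one_iff]; simp
  rw [h2, enegexp_ofReal (mul_nonneg v.coe_nonneg (by linarith)), poissonMeasure,
    lintegral_sum_measure]
  simp_rw [lintegral_smul_measure, lintegral_dirac, h1, smul_eq_mul]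
  have hs := (NormedSpace.expSeries_div_hasSum_exp ((v : ℝ) * Real.exp (-c))).mul_left
    (Real.exp (-v))
  rw [← Real.exp_eq_exp_ℝ, ← Real.exp_add] at hs
  have hterm : ∀ n : ℕ, ENNReal.ofReal (Real.exp (-v) * (v : ℝ) ^ n / n.factorial)
      * ENNReal.ofReal (Real.exp (-c) ^ n)
      = ENNReal.ofReal (Real.exp (-v) * (((v : ℝ) * Real.exp (-c)) ^ n / n.factorial)) := fun n => by
    rw [← ENNReal.ofReal_mul (by positivity)]
    congr 1
    rw [mul_pow]; ring
  simp_rw [hterm]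
  rw [← ENNReal.ofReal_tsum_of_nonneg (fun n => by positivity) hs.summable, hs.tsum_eq]
  congr 2
  ring

namespace IsPoissonPointProcess

variable {Ω : Type*} [MeasurableSpace Ω] {μ : Measure Ω} {X : ℕ → Ω → Plane} {ν : Measure Plane}

lemma measurable_siteCount (hX : IsPoissonPointProcess μ X ν) {A : Set Plane}
    (hA : MeasurableSet A) : Measurable (siteCount X A) :=
  Measurable.tsum fun j =>
    (measurable_one.indicator hA).comp (hX.measurable_point j)

lemma lintegral_enegexp_siteCount (hX : IsPoissonPointProcess μ X ν) {A : Set Plane}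
    (hA : MeasurableSet A) (hν : ν A ≠ ∞) {c : ℝ≥0∞} (hc : c ≠ ∞) :
    ∫⁻ ω, enegexp (c * siteCount X A ω) ∂μ = enegexp (ν A * (1 - enegexp c)) := by
  lift c to NNReal using hc
  have h := lintegral_map (μ := μ) (f := fun u => enegexp (c * u)) (by fun_prop)
    (hX.measurable_siteCount hA)
  rw [← h, hX.count_law A hA hν, lintegral_map (by fun_prop) (by fun_prop),
    lintegral_enegexp_poissonMeasure, ENNReal.coe_toNNReal hν]

/-- The Laplace functional at a simple function supported on a set of finite intensity. -/
lemma lintegral_enegexp_simpleFunc (hX : IsPoissonPointProcess μ X ν) (f : SimpleFunc Plane ℝ≥0∞)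
    (hf : ∀ x, f x ≠ ∞) {K : Set Plane} (hK : MeasurableSet K) (hνK : ν K ≠ ∞) :
    ∫⁻ ω, enegexp (∑' j, K.indicator f (X j ω)) ∂μ
      = enegexp (∫⁻ x, 1 - enegexp (K.indicator f x) ∂ν) := by
  classical
  have hA : ∀ c : ℝ≥0∞, MeasurableSet (f ⁻¹' {c} ∩ K) := fun c =>
    (f.measurableSet_preimage _).inter hK
  have hνA : ∀ c : ℝ≥0∞, ν (f ⁻¹' {c} ∩ K) ≠ ∞ := fun c =>
    measure_ne_top_of_subset Set.inter_subset_right hνK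
  -- Decomposition into level sets of finite intensity: the functional becomes a linear combination
  -- of counts in disjoint sets.
  have hpt : ∀ x, K.indicator f x = ∑ c ∈ f.range, c * (f ⁻¹' {c} ∩ K).indicator 1 x := fun x => by
    rw [Finset.sum_eq_single (f x)]
    · by_cases hx : x ∈ K <;> simp [hx, Set.indicator]
    · intro c _ hc
      simp [Set.indicator, Ne.symm hc]
    · intro h; simp at h
  have hsum : ∀ ω, ∑' j, K.indicator f (X j ω)
      = ∑ c ∈ f.range, c * siteCount X (f ⁻¹' {c} ∩ K) ω := fun ω => by
    simp_rw [hpt, siteCount, ← ENNReal.tsum_mul_left]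
    exact Summable.tsum_finsetSum fun _ _ => ENNReal.summable
  have hone : ∀ x, 1 - enegexp (K.indicator f x)
      = ∑ c ∈ f.range, (1 - enegexp c) * (f ⁻¹' {c} ∩ K).indicator 1 x := fun x => by
    rw [Finset.sum_eq_single (f x)]
    · by_cases hx : x ∈ K <;> simp [hx, Set.indicator, enegexp_zero]
    · intro c _ hc
      simp [Set.indicator, Ne.symm hc]
    · intro h; simp at h
  have hint : ∫⁻ x, 1 - enegexp (K.indicator f x) ∂ν
      = ∑ c ∈ f.range, ν (f ⁻¹' {c} ∩ K) * (1 - enegexp c) := by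
    simp_rw [hone]
    rw [lintegral_finsetSum _ fun c _ => (measurable_one.indicator (hA c)).const_mul _]
    refine Finset.sum_congr rfl fun c _ => ?_
    rw [lintegral_const_mul _ (measurable_one.indicator (hA c)), lintegral_indicator_one (hA c),
      mul_comm]
  -- Level sets are disjoint, so their counts are independent and the Laplace functional factors;
  -- `count_indep` is transported from `Fin` to the range of `f`.
  have hindep : iIndepFun (fun c : f.range => siteCount X (f ⁻¹' {c.1} ∩ K)) μ := by
    have h := hX.count_indep f.range.card
      (fun i => f ⁻¹' {(f.range.equivFin.symm i).1} ∩ K) (fun i => hA _) (fun i => hνA _) ?_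
    · have := h.precomp f.range.equivFin.injective
      simpa [Function.comp_def] using this
    · intro i i' hii
      refine Set.disjoint_left.2 fun x hx hx' => hii ?_
      have := hx.1.symm.trans hx'.1
      exact f.range.equivFin.symm.injective (Subtype.ext this)
  simp_rw [hsum, hint, enegexp_sum]
  rw [← Finset.prod_coe_sort f.range fun c => enegexp (ν (f ⁻¹' {c} ∩ K) * (1 - enegexp c))]
  simp_rw [← Finset.prod_coe_sort f.range fun c => enegexp (c * siteCount X (f ⁻¹' {c} ∩ K) _)]
  rw [lintegral_prod_eq_prod_lintegral_of_indepFun Finset.univ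
    (fun (c : f.range) ω => enegexp (c * siteCount X (f ⁻¹' {c.1} ∩ K) ω))]
  · refine Finset.prod_congr rfl fun c _ => ?_
    refine hX.lintegral_enegexp_siteCount (hA c) (hνA c) ?_
    obtain ⟨x, hx⟩ := SimpleFunc.mem_range.1 c.2
    exact hx ▸ hf x
  · exact hindep.comp (fun (c : f.range) u => enegexp (c * u)) fun c => by fun_prop
  · intro c
    exact measurable_enegexp.comp ((hX.measurable_siteCount (hA c)).const_mul _)

/-- The Laplace functional of a Poisson point process. -/
theorem lintegral_enegexp_tsum [SigmaFinite ν] [IsProbabilityMeasure μ]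
    (hX : IsPoissonPointProcess μ X ν) {u : Plane → ℝ≥0∞} (hu : Measurable u) :
    ∫⁻ ω, enegexp (∑' j, u (X j ω)) ∂μ = enegexp (∫⁻ x, 1 - enegexp (u x) ∂ν) := by
  set K := spanningSets ν
  set f := SimpleFunc.eapprox u
  -- Two truncations at once: finitely many finite values, and support in a set of finite intensity.
  set v : ℕ → Plane → ℝ≥0∞ := fun n => (K n).indicator (f n)
  have hvmeas : ∀ n, Measurable (v n) := fun n =>
    (f n).measurable.indicator (measurableSet_spanningSets ν n)
  have hvmono : Monotone v := fun m n hmn x => by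
    refine (Set.indicator_le_indicator (SimpleFunc.monotone_eapprox u hmn x)).trans ?_
    exact Set.indicator_le_indicator_of_subset (monotone_spanningSets ν hmn) (fun _ => zero_le) x
  have hvsup : ∀ x, ⨆ n, v n x = u x := fun x => by
    apply le_antisymm
    · refine iSup_le fun n => (Set.indicator_le_self _ _ x).trans ?_
      rw [← SimpleFunc.iSup_eapprox_apply hu x]
      exact le_iSup (fun n => f n x) n
    · rw [← SimpleFunc.iSup_eapprox_apply hu x]
      refine iSup_le fun n => ?_
      have hx : x ∈ ⋃ n, K n := by rw [iUnion_spanningSets]; trivial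
      obtain ⟨m, hm⟩ := Set.mem_iUnion.1 hx
      refine le_iSup_of_le (max m n) ?_
      have hmem : x ∈ K (max m n) := monotone_spanningSets ν (le_max_left m n) hm
      simp only [v, Set.indicator_of_mem hmem]
      exact SimpleFunc.monotone_eapprox u (le_max_right m n) x
  have hsimple : ∀ n, ∫⁻ ω, enegexp (∑' j, v n (X j ω)) ∂μ
      = enegexp (∫⁻ x, 1 - enegexp (v n x) ∂ν) := fun n =>
    hX.lintegral_enegexp_simpleFunc (f n)
      (fun x => (SimpleFunc.eapprox_lt_top u n x).ne) (measurableSet_spanningSets ν n)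
      (measure_spanningSets_lt_top ν n).ne
  -- Monotone convergence for the counting measure on the indices.
  have htsum : ∀ ω, ∑' j, u (X j ω) = ⨆ n, ∑' j, v n (X j ω) := fun ω => by
    simp_rw [← hvsup, ← lintegral_count]
    exact lintegral_iSup (fun n => measurable_of_countable _) fun m n hmn j => hvmono hmn _
  have hsum_mono : ∀ ω, Monotone fun n => ∑' j, v n (X j ω) := fun ω m n hmn =>
    ENNReal.tsum_le_tsum fun j => hvmono hmn _
  have hrhs : ∫⁻ x, 1 - enegexp (u x) ∂ν = ⨆ n, ∫⁻ x, 1 - enegexp (v n x) ∂ν := by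
    rw [← lintegral_iSup (fun n => by fun_prop)]
    · refine lintegral_congr fun x => ?_
      rw [← hvsup, one_sub_enegexp_iSup fun m n hmn => hvmono hmn x]
    · exact fun m n hmn x => tsub_le_tsub_left (enegexp_antitone (hvmono hmn x)) _
  have hlim1 : Filter.Tendsto (fun n => ∫⁻ ω, enegexp (∑' j, v n (X j ω)) ∂μ) Filter.atTop
      (nhds (∫⁻ ω, enegexp (∑' j, u (X j ω)) ∂μ)) := by
    refine tendsto_lintegral_of_dominated_convergence (fun _ => 1) (fun n => ?_) (fun n => ?_)
      (by simp) ?_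
    · exact measurable_enegexp.comp
        (Measurable.tsum fun j => (hvmeas n).comp (hX.measurable_point j))
    · exact Filter.Eventually.of_forall fun ω => enegexp_le_one _
    · refine Filter.Eventually.of_forall fun ω => (continuous_enegexp.tendsto _).comp ?_
      rw [htsum]
      exact tendsto_atTop_iSup (hsum_mono ω)
  have hlim2 : Filter.Tendsto (fun n => enegexp (∫⁻ x, 1 - enegexp (v n x) ∂ν)) Filter.atTop
      (nhds (enegexp (∫⁻ x, 1 - enegexp (u x) ∂ν))) := by
    refine (continuous_enegexp.tendsto _).comp ?_
    rw [hrhs]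
    exact tendsto_atTop_iSup fun m n hmn => lintegral_mono fun x =>
      tsub_le_tsub_left (enegexp_antitone (hvmono hmn x)) _
  simp_rw [hsimple] at hlim1
  exact tendsto_nhds_unique hlim1 hlim2

/-- The probability generating functional of a Poisson point process. -/
theorem lintegral_iInf_prod [SigmaFinite ν] [IsProbabilityMeasure μ]
    (hX : IsPoissonPointProcess μ X ν) {w : Plane → ℝ≥0∞} (hw : Measurable w)
    (hw1 : ∀ x, w x ≤ 1) :
    ∫⁻ ω, ⨅ n, ∏ j ∈ Finset.range n, w (X j ω) ∂μ = enegexp (∫⁻ x, 1 - w x ∂ν) := by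
  -- The substitution `u = -log w` allows `w = 0`, where `u = ∞`; this is what later admits void
  -- indicators.
  have := hX.lintegral_enegexp_tsum (u := fun x => eneglog (w x)) (by fun_prop)
  simpa only [enegexp_tsum, enegexp_eneglog (hw1 _)] using this

end IsPoissonPointProcess

/-! ### Radial intensities of the two link types. -/

/-- Integration in polar coordinates of a function of the distance to the origin. -/
lemma lintegral_norm_plane {k : ℝ → ℝ≥0∞} (hk : Measurable k) :
    ∫⁻ x : Plane, k ‖x‖ = ∫⁻ y in Set.Ioi (0 : ℝ), ENNReal.ofReal (2 * Real.pi * y) * k y := by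
  have hmp := (volume : Measure Plane).measurePreserving_homeomorphUnitSphereProd
  have h1 : ∫⁻ x : Plane, k ‖x‖ = ∫⁻ x in ({0}ᶜ : Set Plane), k ‖x‖ := by
    rw [restrict_compl_singleton]
  have h2 := hmp.lintegral_comp (f := fun p => k p.2.1) (by fun_prop)
  simp only [homeomorphUnitSphereProd_apply_snd_coe] at h2
  rw [h1, ← lintegral_subtype_comap (measurableSet_singleton _).compl, h2,
    lintegral_prod _ (by fun_prop)]
  -- The unit circle has mass equal to the dimension times the area of the unit disc, that is `2 *
  -- π`.
  simp only [lintegral_const, finrank_euclideanSpace, Fintype.card_fin, Measure.toSphere_apply_univ,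
    EuclideanSpace.volume_ball_fin_two]
  rw [Measure.volumeIoiPow, lintegral_withDensity_eq_lintegral_mul _ (by fun_prop) (by fun_prop)]
  simp only [Pi.mul_apply]
  rw [lintegral_subtype_comap measurableSet_Ioi
    (fun y : ℝ => ENNReal.ofReal (y ^ (2 - 1)) * k y), mul_comm,
    ← lintegral_const_mul _ (by fun_prop)]
  refine setLIntegral_congr_fun measurableSet_Ioi fun y hy => ?_
  rw [← mul_assoc]
  congr 1
  rw [ENNReal.ofReal_mul (by positivity), ENNReal.ofReal_mul (by positivity)]
  simp

namespace NetworkParams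

variable {M : ℕ} (N : NetworkParams M)

lemma linkProb_nonneg (p : LinkType) {y : ℝ} (hy : 0 ≤ y) : 0 ≤ N.linkProb p y := by
  cases p
  · exact (Real.exp_pos _).le
  · have : Real.exp (-N.beta * y) ≤ 1 := by
      rw [Real.exp_le_one_iff]; nlinarith [mul_nonneg N.beta_nonneg hy]
    simp only [linkProb]; linarith

lemma continuous_linkProb (p : LinkType) : Continuous (N.linkProb p) := by
  cases p
  · change Continuous fun y => Real.exp (-N.beta * y)
    fun_prop
  · change Continuous fun y => 1 - Real.exp (-N.beta * y)
    fun_prop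

lemma sum_linkProb (y : ℝ) : ∑ p, N.linkProb p y = 1 := by
  have : (Finset.univ : Finset LinkType) = {LinkType.los, LinkType.nlos} := rfl
  rw [this, Finset.sum_pair (by decide)]
  simp [linkProb]

lemma sum_ofReal_linkProb {y : ℝ} (hy : 0 ≤ y) : ∑ p, ENNReal.ofReal (N.linkProb p y) = 1 := by
  rw [← ENNReal.ofReal_sum_of_nonneg fun p _ => N.linkProb_nonneg p hy, sum_linkProb,
    ENNReal.ofReal_one]

/-- The intensity measure of the distances of the sites of link type `p`. -/
noncomputable def intensity (p : LinkType) : Measure ℝ :=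
  (volume.restrict (Set.Ioi 0)).withDensity
    fun y => ENNReal.ofReal (2 * Real.pi * N.lam * N.linkProb p y * y)

lemma lintegral_intensity (p : LinkType) {k : ℝ → ℝ≥0∞} (hk : Measurable k) :
    ∫⁻ y, k y ∂N.intensity p
      = ∫⁻ y in Set.Ioi 0, ENNReal.ofReal (2 * Real.pi * N.lam * N.linkProb p y * y) * k y := by
  have := (N.continuous_linkProb p).measurable
  rw [intensity, lintegral_withDensity_eq_lintegral_mul _ (by fun_prop) hk]
  rfl

/-- Polar coordinates split the planar intensity, weighted by the type probabilities, into one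
radial intensity per link type. -/
lemma lintegral_site_plane {k : LinkType → ℝ → ℝ≥0∞} (hk : ∀ p, Measurable (k p)) :
    ∫⁻ x : Plane, ∑ p, ENNReal.ofReal (N.linkProb p ‖x‖) * k p ‖x‖
        ∂(ENNReal.ofReal N.lam • volume)
      = ∑ p, ∫⁻ y, k p y ∂N.intensity p := by
  have hm := fun p => (N.continuous_linkProb p).measurable
  rw [lintegral_smul_measure, lintegral_norm_plane
    (k := fun y => ∑ p, ENNReal.ofReal (N.linkProb p y) * k p y) (by fun_prop), smul_eq_mul,
    ← lintegral_const_mul _ (by fun_prop)]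
  simp_rw [N.lintegral_intensity _ (hk _)]
  rw [← lintegral_finsetSum _ (fun p _ => by have := hm p; have := hk p; fun_prop)]
  refine setLIntegral_congr_fun measurableSet_Ioi fun y (hy : 0 < y) => ?_
  simp only [Finset.mul_sum]
  refine Finset.sum_congr rfl fun p _ => ?_
  rw [← mul_assoc, ← mul_assoc, ← ENNReal.ofReal_mul N.lam_pos.le, ← ENNReal.ofReal_mul
    (mul_nonneg N.lam_pos.le (by positivity))]
  congr 2
  ring

variable {N} {Ω : Type*} [MeasurableSpace Ω] {μ : Measure Ω}
    {X : ℕ → Ω → Plane} {s : ℕ → Ω → LinkType} {h θ : Fin M → ℕ → Ω → ℝ}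

/-! ### Generating functional of the sites marked by link type. -/

namespace IsColocated

/-- Integrating out the link types of finitely many sites. -/
lemma lintegral_prod_types (hsys : N.IsColocated μ X s h θ) {w : LinkType → ℝ → ℝ≥0∞}
    (hw : ∀ p, Measurable (w p)) (J : Finset ℕ) :
    ∫⁻ ω, ∏ j ∈ J, w (s j ω) ‖X j ω‖ ∂μ
      = ∫⁻ ω, ∏ j ∈ J, ∑ p, ENNReal.ofReal (N.linkProb p ‖X j ω‖) * w p ‖X j ω‖ ∂μ := by
  classical
  have hXm : Measurable fun ω j => X j ω := measurable_pi_iff.2 hsys.sites.measurable_point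
  have hpm := fun p => (N.continuous_linkProb p).measurable
  have hXj := hsys.sites.measurable_point
  -- The default type outside `J` is never inspected.
  let ext : (J → LinkType) → ℕ → LinkType := fun τ j => if hj : j ∈ J then τ ⟨j, hj⟩ else .los
  -- `types_law` says that restricting to a type configuration, or weighting by its conditional
  -- probability, gives the same law of the sites; hence the two integrals of any `F` agree.
  have hkey : ∀ (τ : ℕ → LinkType) (F : (ℕ → Plane) → ℝ≥0∞), Measurable F →
      ∫⁻ ω in {ω | ∀ j ∈ J, s j ω = τ j}, F (fun j => X j ω) ∂μ
        = ∫⁻ ω, (∏ j ∈ J, ENNReal.ofReal (N.linkProb (τ j) ‖X j ω‖)) * F (fun j => X j ω) ∂μ := by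
    intro τ F hF
    have hmeas : Measurable fun ω => ∏ j ∈ J, ENNReal.ofReal (N.linkProb (τ j) ‖X j ω‖) := by
      refine Finset.measurable_prod _ fun j _ => ?_
      have := hpm (τ j); have := hXj j
      fun_prop
    have hmap : (μ.restrict {ω | ∀ j ∈ J, s j ω = τ j}).map (fun ω j => X j ω)
        = (μ.withDensity fun ω => ∏ j ∈ J, ENNReal.ofReal (N.linkProb (τ j) ‖X j ω‖)).map
          (fun ω j => X j ω) := by
      ext B hB
      rw [Measure.map_apply hXm hB, Measure.map_apply hXm hB, Measure.restrict_apply (hXm hB),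
        withDensity_apply _ (hXm hB)]
      exact hsys.types_law J τ B hB
    rw [← lintegral_map (μ := μ.restrict _) hF hXm, hmap, lintegral_map hF hXm,
      lintegral_withDensity_eq_lintegral_mul _ hmeas
        (show Measurable fun ω => F fun j => X j ω from hF.comp hXm)]
    rfl
  have hsplit : ∀ ω, ∏ j ∈ J, w (s j ω) ‖X j ω‖ = ∑ τ : J → LinkType,
      {ω | ∀ j ∈ J, s j ω = ext τ j}.indicator (fun ω => ∏ j ∈ J, w (ext τ j) ‖X j ω‖) ω := by
    intro ω
    rw [Finset.sum_eq_single (fun j : J => s j ω)]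
    · rw [Set.indicator_of_mem]
      · exact Finset.prod_congr rfl fun j hj => by simp [ext, hj]
      · intro j hj; simp [ext, hj]
    · intro τ _ hτ
      rw [Set.indicator_of_notMem]
      intro hmem
      refine hτ (funext fun j => ?_)
      have := hmem j.1 j.2
      simp only [ext, j.2, dif_pos] at this
      exact this.symm
    · simp
  have hset : ∀ τ : ℕ → LinkType, MeasurableSet {ω | ∀ j ∈ J, s j ω = τ j} := fun τ => by
    have : {ω | ∀ j ∈ J, s j ω = τ j} = ⋂ j ∈ J, s j ⁻¹' {τ j} := by ext; simp
    rw [this]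
    exact Finset.measurableSet_biInter _ fun j _ => hsys.measurable_type j trivial
  have hFm : ∀ τ : ℕ → LinkType, Measurable fun x : ℕ → Plane => ∏ j ∈ J, w (τ j) ‖x j‖ := fun τ =>
    Finset.measurable_prod _ fun j _ => by have := hw (τ j); fun_prop
  have hFXm : ∀ τ : ℕ → LinkType, Measurable fun ω => ∏ j ∈ J, w (τ j) ‖X j ω‖ := fun τ =>
    (hFm τ).comp hXm
  simp_rw [hsplit]
  rw [lintegral_finsetSum _ fun τ _ => (hFXm (ext τ)).indicator (hset _)]
  simp_rw [fun τ => lintegral_indicator (hset (ext τ)) (μ := μ),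
    fun τ => hkey (ext τ) _ (hFm (ext τ))]
  rw [← lintegral_finsetSum]
  · refine lintegral_congr fun ω => ?_
    -- The sum over all type configurations on `J` is the expanded product of sums over types.
    rw [← Finset.prod_coe_sort J, Finset.prod_univ_sum, Fintype.piFinset_univ]
    refine Finset.sum_congr rfl fun τ _ => ?_
    rw [← Finset.prod_mul_distrib, ← Finset.prod_coe_sort J]
    exact Finset.prod_congr rfl fun j _ => by simp [ext]
  · intro τ _
    refine (Finset.measurable_prod _ fun j _ => ?_).mul (hFXm (ext τ))
    have := hpm (ext τ j); have := hXj j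
    fun_prop

lemma antitone_prod_range {a : ℕ → ℝ≥0∞} (ha : ∀ j, a j ≤ 1) :
    Antitone fun n => ∏ j ∈ Finset.range n, a j :=
  antitone_nat_of_succ_le fun n => by
    rw [Finset.prod_range_succ]
    exact mul_le_of_le_one_right' (ha n)

/-- The probability generating functional of the marked point process of link types and
distances. -/
theorem lintegral_iInf_prod [IsProbabilityMeasure μ] (hsys : N.IsColocated μ X s h θ)
    {w : LinkType → ℝ → ℝ≥0∞} (hw : ∀ p, Measurable (w p)) (hw1 : ∀ p y, w p y ≤ 1) :
    ∫⁻ ω, ⨅ n, ∏ j ∈ Finset.range n, w (s j ω) ‖X j ω‖ ∂μ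
      = enegexp (∑ p, ∫⁻ y, 1 - w p y ∂N.intensity p) := by
  have hpm := fun p => (N.continuous_linkProb p).measurable
  have hXj := hsys.sites.measurable_point
  have hWle : ∀ x : Plane, ∑ p, ENNReal.ofReal (N.linkProb p ‖x‖) * w p ‖x‖ ≤ 1 := fun x => by
    rw [← N.sum_ofReal_linkProb (norm_nonneg x)]
    exact Finset.sum_le_sum fun p _ => mul_le_of_le_one_right' (hw1 _ _)
  have hWm : Measurable fun x : Plane => ∑ p, ENNReal.ofReal (N.linkProb p ‖x‖) * w p ‖x‖ := by
    fun_prop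
  have hlm : ∀ j, Measurable fun ω => w (s j ω) ‖X j ω‖ := fun j => by
    have h1 : Measurable fun q : LinkType × ℝ => w q.1 q.2 :=
      measurable_from_prod_countable_right hw
    exact h1.comp ((hsys.measurable_type j).prodMk (hXj j).norm)
  -- The types can be integrated out only from finite products: the infimum is moved outside the
  -- integral here and back inside afterwards, by monotone convergence from above.
  rw [lintegral_iInf (fun n => Finset.measurable_prod _ fun j _ => hlm j)
    (fun m n hmn ω => antitone_prod_range (fun j => hw1 _ _) hmn) (by simp)]
  simp_rw [hsys.lintegral_prod_types hw]
  have hWXm : ∀ j, Measurable fun ω => ∑ p, ENNReal.ofReal (N.linkProb p ‖X j ω‖) * w p ‖X j ω‖ :=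
    fun j => hWm.comp (hXj j)
  rw [← lintegral_iInf (fun n => Finset.measurable_prod _ fun j _ => hWXm j)
    (fun m n hmn ω => antitone_prod_range (fun j => hWle _) hmn) (by simp)]
  have : SigmaFinite (ENNReal.ofReal N.lam • (volume : Measure Plane)) := by
    change SigmaFinite (Real.toNNReal N.lam • (volume : Measure Plane))
    infer_instance
  rw [hsys.sites.lintegral_iInf_prod hWm hWle, ← N.lintegral_site_plane (fun p => by
    have := hw p; fun_prop)]
  congr 1
  refine lintegral_congr fun x => ?_
  have hsum := N.sum_ofReal_linkProb (norm_nonneg x)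
  have hne : ∑ p, ENNReal.ofReal (N.linkProb p ‖x‖) * w p ‖x‖ ≠ ∞ :=
    ((hWle x).trans_lt ENNReal.one_lt_top).ne
  -- The type probabilities sum to one, so `1 - ∑ p, prob p * w p = ∑ p, prob p * (1 - w p)`.
  refine ENNReal.sub_eq_of_eq_add hne ?_
  rw [← Finset.sum_add_distrib]
  refine hsum.symm.trans (Finset.sum_congr rfl fun p _ => ?_)
  rw [← mul_add, tsub_add_cancel_of_le (hw1 _ _), mul_one]

end IsColocated

end NetworkParams

/-! ### Law of the smallest point of a Poisson process on the half-line. -/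

/-- The law of the smallest point of a Poisson process on the half-line with intensity `ρ`. -/
noncomputable def minLaw (ρ : Measure ℝ) : Measure ℝ≥0∞ :=
  (ρ.withDensity fun y => enegexp (ρ (Set.Iio y))).map ENNReal.ofReal
    + enegexp (ρ Set.univ) • Measure.dirac ∞

@[fun_prop]
lemma measurable_measure_Iio (ρ : Measure ℝ) : Measurable fun y => ρ (Set.Iio y) :=
  Monotone.measurable fun _ _ hab => measure_mono (Set.Iio_subset_Iio hab)

/-- The measure on the half-line with density `f`. -/
noncomputable def halfLineMeasure (f : ℝ → ℝ) : Measure ℝ :=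
  (volume.restrict (Set.Ioi 0)).withDensity fun y => ENNReal.ofReal (f y)

section HalfLine

variable {f : ℝ → ℝ}

lemma halfLineMeasure_Iio (hf0 : ∀ y, 0 < y → 0 ≤ f y)
    (hfi : ∀ b, IntegrableOn f (Set.Ioc 0 b)) {y : ℝ} (hy : 0 ≤ y) :
    halfLineMeasure f (Set.Iio y) = ENNReal.ofReal (∫ z in (0)..y, f z) := by
  rw [halfLineMeasure, withDensity_apply _ measurableSet_Iio,
    Measure.restrict_restrict measurableSet_Iio, Set.Iio_inter_Ioi,
    setLIntegral_congr Ioo_ae_eq_Ioc, intervalIntegral.integral_of_le hy,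
    ofReal_integral_eq_lintegral_ofReal (hfi y)]
  filter_upwards [ae_restrict_mem measurableSet_Ioc] with z hz using hf0 z hz.1

/-- With `F` the primitive of `f`, the integrand is `f * exp (-F)`, the derivative of `-exp (-F)`.
Continuity of `f` is required only on `(0, ∞)`, since path losses are singular at the origin. -/
lemma setLIntegral_enegexp_halfLineMeasure (hf0 : ∀ y, 0 < y → 0 ≤ f y)
    (hfi : ∀ b, IntegrableOn f (Set.Ioc 0 b)) (hfm : Measurable f)
    (hfc : ContinuousOn f (Set.Ioi 0)) {b : ℝ} (hb : 0 ≤ b) :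
    ∫⁻ y in Set.Iio b, enegexp (halfLineMeasure f (Set.Iio y)) ∂(halfLineMeasure f)
      = 1 - enegexp (halfLineMeasure f (Set.Iio b)) := by
  set F : ℝ → ℝ := fun y => ∫ z in (0)..y, f z
  have hFnn : ∀ y, 0 ≤ y → 0 ≤ F y := fun y hy =>
    intervalIntegral.integral_nonneg_of_ae_restrict hy (by
      rw [← restrict_Ioc_eq_restrict_Icc]
      filter_upwards [ae_restrict_mem measurableSet_Ioc] with z hz using hf0 z hz.1)
  have hint : ∀ y, 0 ≤ y → IntervalIntegrable f volume 0 y := fun y hy =>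
    (intervalIntegrable_iff_integrableOn_Ioc_of_le hy).2 (hfi y)
  have hFc : ContinuousOn F (Set.Icc 0 b) := by
    have := intervalIntegral.continuousOn_primitive_interval (f := f) (μ := volume) (a := 0) (b := b)
      (by rw [Set.uIcc_of_le hb, integrableOn_Icc_iff_integrableOn_Ioc]; exact hfi b)
    rwa [Set.uIcc_of_le hb] at this
  have hFd : ∀ y ∈ Set.Ioo 0 b, HasDerivAt F (f y) y := fun y hy =>
    intervalIntegral.integral_hasDerivAt_right (hint y hy.1.le)
      hfm.stronglyMeasurable.stronglyMeasurableAtFilter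
      (hfc.continuousAt (Ioi_mem_nhds hy.1))
  have hGi : IntegrableOn (fun y => f y * Real.exp (-F y)) (Set.Ioc 0 b) := by
    refine Integrable.mul_bdd (c := 1) (hfi b) ?_ ?_
    · exact (Real.continuous_exp.comp_continuousOn (hFc.mono Set.Ioc_subset_Icc_self).neg).aestronglyMeasurable
        measurableSet_Ioc
    · filter_upwards [ae_restrict_mem measurableSet_Ioc] with z hz
      rw [Real.norm_eq_abs, Real.abs_exp, Real.exp_le_one_iff]
      linarith [hFnn z hz.1.le]
  have hFTC : ∫ y in (0)..b, f y * Real.exp (-F y) = 1 - Real.exp (-F b) := by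
    have h0 : F 0 = 0 := intervalIntegral.integral_same
    have := intervalIntegral.integral_eq_sub_of_hasDerivAt_of_le hb
      (f := fun y => -Real.exp (-F y)) (f' := fun y => f y * Real.exp (-F y))
      (Real.continuous_exp.comp_continuousOn hFc.neg).neg
      (fun y hy => by
        have : HasDerivAt (fun y => -Real.exp (-F y)) (-(Real.exp (-F y) * -f y)) y :=
          ((hFd y hy).neg.exp).neg
        rwa [mul_neg, neg_neg, mul_comm] at this)
      ((intervalIntegrable_iff_integrableOn_Ioc_of_le hb).2 hGi)
    rw [this, h0]; simp; ring
  rw [halfLineMeasure_Iio hf0 hfi hb, enegexp_ofReal (hFnn b hb), ← ENNReal.ofReal_one,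
    ← ENNReal.ofReal_sub _ (Real.exp_pos _).le, ← hFTC]
  rw [show halfLineMeasure f = (volume.restrict (Set.Ioi 0)).withDensity
    fun y => ENNReal.ofReal (f y) from rfl]
  rw [setLIntegral_withDensity_eq_setLIntegral_mul _ (by fun_prop) (by fun_prop) measurableSet_Iio,
    Measure.restrict_restrict measurableSet_Iio, Set.Iio_inter_Ioi,
    setLIntegral_congr Ioo_ae_eq_Ioc, intervalIntegral.integral_of_le hb,
    ofReal_integral_eq_lintegral_ofReal hGi]
  · refine setLIntegral_congr_fun measurableSet_Ioc fun y hy => ?_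
    simp only [Pi.mul_apply]
    rw [ENNReal.ofReal_mul (hf0 y hy.1), ← enegexp_ofReal (hFnn y hy.1.le),
      ← halfLineMeasure_Iio hf0 hfi hy.1.le]
    rfl
  · filter_upwards [ae_restrict_mem measurableSet_Ioc] with z hz
    exact mul_nonneg (hf0 z hz.1) (Real.exp_pos _).le

end HalfLine

lemma ofReal_preimage_Iio_eq {a : ℝ≥0∞} (h0 : a ≠ 0) (ha : a ≠ ∞) :
    ENNReal.ofReal ⁻¹' Set.Iio a = Set.Iio a.toReal := by
  ext y
  simp only [Set.mem_preimage, Set.mem_Iio]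
  nth_rewrite 1 [← ENNReal.ofReal_toReal ha]
  exact ENNReal.ofReal_lt_ofReal_iff (ENNReal.toReal_pos h0 ha)

/-- An integrated form of `(exp (-ρ (Iio y)))' = -exp (-ρ (Iio y)) ρ'`. -/
def HasExpTail (ρ : Measure ℝ) : Prop :=
  ∀ b, 0 ≤ b → ∫⁻ y in Set.Iio b, enegexp (ρ (Set.Iio y)) ∂ρ = 1 - enegexp (ρ (Set.Iio b))

section MinLaw

variable {ρ : Measure ℝ}

lemma HasExpTail.lintegral_univ (hρ : HasExpTail ρ) :
    ∫⁻ y, enegexp (ρ (Set.Iio y)) ∂ρ = 1 - enegexp (ρ Set.univ) := by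
  have hmono : Monotone fun n : ℕ => Set.Iio (n : ℝ) := fun m n hmn =>
    Set.Iio_subset_Iio (by exact_mod_cast hmn)
  have huniv : ⋃ n : ℕ, Set.Iio (n : ℝ) = Set.univ :=
    Set.iUnion_eq_univ_iff.2 fun x => exists_nat_gt x
  have h1 := hmono.measure_iUnion (μ := ρ)
  have h2 := hmono.measure_iUnion (μ := ρ.withDensity fun y => enegexp (ρ (Set.Iio y)))
  rw [huniv] at h1 h2
  rw [withDensity_apply _ .univ, setLIntegral_univ] at h2
  simp_rw [withDensity_apply _ (measurableSet_Iio (α := ℝ))] at h2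
  rw [h2, h1, one_sub_enegexp_iSup fun m n hmn => measure_mono (hmono hmn)]
  exact iSup_congr fun n => hρ n (Nat.cast_nonneg n)

lemma minLaw_univ (hρ : HasExpTail ρ) : minLaw ρ Set.univ = 1 := by
  rw [minLaw, Measure.add_apply, Measure.map_apply ENNReal.measurable_ofReal .univ, Set.preimage_univ,
    withDensity_apply _ .univ, setLIntegral_univ, hρ.lintegral_univ]
  simp only [Measure.smul_apply, measure_univ, smul_eq_mul, mul_one]
  exact tsub_add_cancel_of_le (enegexp_le_one _)

lemma isProbabilityMeasure_minLaw (hρ : HasExpTail ρ) : IsProbabilityMeasure (minLaw ρ) := ⟨minLaw_univ hρ⟩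

/-- The minimum is at least `a` when there is no point below `a`. The atom at `∞` carries the
probability of an empty process and stays out of `Iio a`, even for `a = ∞`, so the complement is
computed by `HasExpTail`. -/
lemma minLaw_Ici (hρ : HasExpTail ρ) (a : ℝ≥0∞) :
    minLaw ρ (Set.Ici a) = enegexp (ρ (ENNReal.ofReal ⁻¹' Set.Iio a)) := by
  have := isProbabilityMeasure_minLaw hρ
  have h1 : minLaw ρ (Set.Iio a) = 1 - enegexp (ρ (ENNReal.ofReal ⁻¹' Set.Iio a)) := by
    rw [minLaw, Measure.add_apply, Measure.map_apply ENNReal.measurable_ofReal measurableSet_Iio,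
      withDensity_apply _ (ENNReal.measurable_ofReal measurableSet_Iio)]
    have hd : (enegexp (ρ Set.univ) • Measure.dirac (∞ : ℝ≥0∞)) (Set.Iio a) = 0 := by
      simp
    rw [hd, add_zero]
    by_cases h0 : a = 0
    · simp [h0, enegexp_zero]
    by_cases ha : a = ∞
    · have : ENNReal.ofReal ⁻¹' Set.Iio a = Set.univ := by
        ext; simp [ha]
      rw [this, setLIntegral_univ, hρ.lintegral_univ]
    · rw [ofReal_preimage_Iio_eq h0 ha, hρ _ ENNReal.toReal_nonneg]
  rw [← Set.compl_Iio, prob_compl_eq_one_sub measurableSet_Iio, h1,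
    ENNReal.sub_sub_cancel ENNReal.one_ne_top (enegexp_le_one _)]

/-- Absence of finite atoms is what rules out ties in received power between the two types. -/
lemma minLaw_singleton (hac : ρ ≪ volume.restrict (Set.Ioi 0)) {c : ℝ≥0∞} (hc : c ≠ ∞) :
    minLaw ρ {c} = 0 := by
  rw [minLaw, Measure.add_apply,
    Measure.map_apply ENNReal.measurable_ofReal (measurableSet_singleton c)]
  have h1 : (enegexp (ρ Set.univ) • Measure.dirac (∞ : ℝ≥0∞)) {c} = 0 := by
    simp [hc.symm]
  have h2 : (ρ.withDensity fun y => enegexp (ρ (Set.Iio y))) (ENNReal.ofReal ⁻¹' {c}) = 0 := by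
    refine ((withDensity_absolutelyContinuous _ _).trans hac) ?_
    rw [Measure.restrict_apply (ENNReal.measurable_ofReal (measurableSet_singleton c))]
    refine measure_mono_null ?_ (measure_singleton c.toReal)
    rintro y ⟨hy, hy0⟩
    rw [Set.mem_preimage, Set.mem_singleton_iff] at hy
    rw [Set.mem_singleton_iff, ← hy, ENNReal.toReal_ofReal (le_of_lt hy0)]
  rw [h1, h2, add_zero]

lemma lintegral_minLaw {k : ℝ≥0∞ → ℝ≥0∞} (hk : Measurable k) (htop : k ∞ = 0) :
    ∫⁻ a, k a ∂minLaw ρ = ∫⁻ y, enegexp (ρ (Set.Iio y)) * k (ENNReal.ofReal y) ∂ρ := by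
  rw [minLaw, lintegral_add_measure, lintegral_smul_measure, lintegral_dirac' _ hk, htop,
    lintegral_map hk ENNReal.measurable_ofReal, smul_zero, add_zero,
    lintegral_withDensity_eq_lintegral_mul _ 
      (show Measurable fun y => enegexp (ρ (Set.Iio y)) from
        measurable_enegexp.comp (measurable_measure_Iio ρ)) (by fun_prop)]
  rfl

end MinLaw

lemma LinkType.univ_eq_pair {p q : LinkType} (hpq : p ≠ q) :
    (Finset.univ : Finset LinkType) = {p, q} := by
  cases p <;> cases q <;> first | exact absurd rfl hpq | decide

/-! ### Nearest sites of each type under a product weight. -/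

namespace NetworkParams

variable {M : ℕ} (N : NetworkParams M) {Ω : Type*} (X : ℕ → Ω → Plane) (s : ℕ → Ω → LinkType)

/-- The smallest distance of a site of link type `p`. -/
noncomputable def nearest (p : LinkType) (ω : Ω) : ℝ≥0∞ :=
  ⨅ j, if s j ω = p then ‖X j ω‖ₑ else ∞

/-- The product of the factors `g` of all sites. -/
noncomputable def weight (g : LinkType → ℝ → ℝ≥0∞) (ω : Ω) : ℝ≥0∞ :=
  ⨅ n, ∏ j ∈ Finset.range n, g (s j ω) ‖X j ω‖

variable {X s}

lemma le_nearest_iff {p : LinkType} {a : ℝ≥0∞} {ω : Ω} :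
    a ≤ nearest X s p ω ↔ ∀ j, s j ω = p → a ≤ ‖X j ω‖ₑ := by
  rw [nearest, le_iInf_iff]
  refine forall_congr' fun j => ?_
  split_ifs with h <;> simp [h]

namespace IsColocated

variable {N} [MeasurableSpace Ω] {μ : Measure Ω} {h θ : Fin M → ℕ → Ω → ℝ}

lemma measurable_nearest (hsys : N.IsColocated μ X s h θ) (p : LinkType) :
    Measurable (nearest X s p) := by
  refine Measurable.iInf fun j => Measurable.ite ?_ (hsys.sites.measurable_point j).enorm
    measurable_const
  exact hsys.measurable_type j (measurableSet_singleton p)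

lemma measurable_mark (hsys : N.IsColocated μ X s h θ) {g : LinkType → ℝ → ℝ≥0∞}
    (hg : ∀ p, Measurable (g p)) (j : ℕ) : Measurable fun ω => g (s j ω) ‖X j ω‖ := by
  have h1 : Measurable fun q : LinkType × ℝ => g q.1 q.2 :=
    measurable_from_prod_countable_right hg
  exact h1.comp ((hsys.measurable_type j).prodMk (hsys.sites.measurable_point j).norm)

lemma measurable_weight (hsys : N.IsColocated μ X s h θ) {g : LinkType → ℝ → ℝ≥0∞}
    (hg : ∀ p, Measurable (g p)) : Measurable (weight X s g) :=
  Measurable.iInf fun _ => Finset.measurable_prod _ fun j _ => hsys.measurable_mark hg j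

/-- The weighted probability that there is no site of type `r` at distance below `d r`. -/
lemma setLIntegral_weight_void [IsProbabilityMeasure μ] (hsys : N.IsColocated μ X s h θ)
    {g : LinkType → ℝ → ℝ≥0∞} (hg : ∀ p, Measurable (g p)) (hg1 : ∀ p y, g p y ≤ 1)
    (d : LinkType → ℝ≥0∞) :
    ∫⁻ ω in {ω | ∀ r, d r ≤ nearest X s r ω}, weight X s g ω ∂μ
      = enegexp (∑ r, ∫⁻ y, 1 - g r y ∂N.intensity r)
        * ∏ r, enegexp ((N.intensity r).withDensity (g r) (ENNReal.ofReal ⁻¹' Set.Iio (d r))) := by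
  have hset : MeasurableSet {ω | ∀ r, d r ≤ nearest X s r ω} := by
    have : {ω | ∀ r, d r ≤ nearest X s r ω} = ⋂ r, {ω | d r ≤ nearest X s r ω} := by ext; simp
    rw [this]
    exact MeasurableSet.iInter fun r => measurableSet_le measurable_const (hsys.measurable_nearest r)
  have hpre : ∀ r, MeasurableSet (ENNReal.ofReal ⁻¹' Set.Iio (d r)) := fun r =>
    ENNReal.measurable_ofReal measurableSet_Iio
  -- The void indicator is absorbed into the weight by setting the factor of type `r` to zero at
  -- distances below `d r`.
  set w : LinkType → ℝ → ℝ≥0∞ := fun r => (ENNReal.ofReal ⁻¹' Set.Iio (d r))ᶜ.indicator (g r)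
  have hw : ∀ r, Measurable (w r) := fun r => (hg r).indicator (hpre r).compl
  have hw1 : ∀ r y, w r y ≤ 1 := fun r y => (Set.indicator_le_self _ _ y).trans (hg1 r y)
  have hpt : ∀ ω, {ω | ∀ r, d r ≤ nearest X s r ω}.indicator (weight X s g) ω
      = weight X s w ω := by
    intro ω
    by_cases hω : ∀ r, d r ≤ nearest X s r ω
    · rw [Set.indicator_of_mem (by exact hω)]
      refine iInf_congr fun n => Finset.prod_congr rfl fun j _ => ?_
      have := le_nearest_iff.1 (hω (s j ω)) j rfl
      simp only [w]
      rw [Set.indicator_of_mem]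
      simpa using this
    · rw [Set.indicator_of_notMem (by exact hω)]
      push Not at hω
      obtain ⟨r, hr⟩ := hω
      rw [← not_le, le_nearest_iff] at hr
      push Not at hr
      obtain ⟨j, rfl, hj⟩ := hr
      -- A site `j` in the forbidden region contributes a zero factor to the partial product of
      -- length `j + 1`.
      refine (le_antisymm (iInf_le_of_le (j + 1) ?_) zero_le).symm
      rw [Finset.prod_range_succ]
      simp only [w]
      rw [Set.indicator_of_notMem (a := ‖X j ω‖), mul_zero]
      simpa using hj
  rw [← lintegral_indicator hset]
  simp_rw [hpt]
  -- Inside the forbidden region `1 - w = 1 = (1 - g) + g`, outside `1 - w = 1 - g`; so the exponent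
  -- splits into a common constant and a void term.
  have hsub : ∀ r, ∫⁻ y, 1 - w r y ∂N.intensity r = ∫⁻ y, 1 - g r y ∂N.intensity r
      + (N.intensity r).withDensity (g r) (ENNReal.ofReal ⁻¹' Set.Iio (d r)) := by
    intro r
    rw [withDensity_apply _ (hpre r), ← lintegral_indicator (hpre r),
      ← lintegral_add_left (by have := hg r; fun_prop)]
    refine lintegral_congr fun y => ?_
    by_cases hy : y ∈ ENNReal.ofReal ⁻¹' Set.Iio (d r)
    · simp only [w]
      rw [Set.indicator_of_notMem (by simpa using hy), Set.indicator_of_mem hy, tsub_zero,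
        tsub_add_cancel_of_le (hg1 r y)]
    · simp only [w]
      rw [Set.indicator_of_mem (by exact hy), Set.indicator_of_notMem hy, add_zero]
  rw [show (∫⁻ ω, weight X s w ω ∂μ) = _ from hsys.lintegral_iInf_prod hw hw1]
  simp_rw [hsub]
  rw [Finset.sum_add_distrib, enegexp_add, enegexp_sum Finset.univ fun r =>
    (N.intensity r).withDensity (g r) (ENNReal.ofReal ⁻¹' Set.Iio (d r))]

/-- Under the weighted measure, the nearest sites of the two types are independent, and their
distances have the law of the smallest point of a Poisson process. -/
theorem map_nearest [IsProbabilityMeasure μ] (hsys : N.IsColocated μ X s h θ)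
    {g : LinkType → ℝ → ℝ≥0∞} (hg : ∀ p, Measurable (g p)) (hg1 : ∀ p y, g p y ≤ 1)
    (htail : ∀ p, HasExpTail ((N.intensity p).withDensity (g p))) {p q : LinkType} (hpq : p ≠ q) :
    (μ.withDensity (weight X s g)).map (fun ω => (nearest X s p ω, nearest X s q ω))
      = enegexp (∑ r, ∫⁻ y, 1 - g r y ∂N.intensity r) •
        (minLaw ((N.intensity p).withDensity (g p))).prod
          (minLaw ((N.intensity q).withDensity (g q))) := by
  set A := enegexp (∑ r, ∫⁻ y, 1 - g r y ∂N.intensity r)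
  have hA : A ≠ ∞ := enegexp_ne_top _
  have hp := isProbabilityMeasure_minLaw (htail p)
  have hq := isProbabilityMeasure_minLaw (htail q)
  have hnm : Measurable fun ω => (nearest X s p ω, nearest X s q ω) :=
    (hsys.measurable_nearest p).prodMk (hsys.measurable_nearest q)
  have hAp : IsFiniteMeasure (A • minLaw ((N.intensity p).withDensity (g p))) :=
    Measure.smul_finite _ hA
  have hspan : ∀ ν : Measure ℝ≥0∞, IsFiniteMeasure ν → ν.FiniteSpanningSetsIn (Set.range Set.Ici) :=
    fun ν _ => ⟨fun _ => Set.univ, fun _ => ⟨0, by ext; simp⟩, fun _ => measure_lt_top _ _,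
      Set.iUnion_const _⟩
  have hgen : MeasurableSpace.generateFrom (Set.range Set.Ici)
      = (inferInstance : MeasurableSpace ℝ≥0∞) :=
    ((BorelSpace.measurable_eq (α := ℝ≥0∞)).trans (borel_eq_generateFrom_Ici ℝ≥0∞)).symm
  -- The constant joins the first factor, leaving a product of finite measures that is determined by
  -- its values on rectangles `Ici a ×ˢ Ici b`; these are weighted void probabilities.
  rw [← Measure.prod_smul_left]
  symm
  refine Measure.prod_eq_generateFrom hgen hgen isPiSystem_Ici isPiSystem_Ici
    (hspan _ hAp) (hspan _ inferInstance) ?_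
  rintro _ ⟨a, rfl⟩ _ ⟨b, rfl⟩
  rw [Measure.map_apply hnm (measurableSet_Ici.prod measurableSet_Ici),
    withDensity_apply _ (hnm (measurableSet_Ici.prod measurableSet_Ici)), Measure.smul_apply,
    minLaw_Ici (htail p), minLaw_Ici (htail q), smul_eq_mul, mul_assoc]
  have := hsys.setLIntegral_weight_void hg hg1 (fun r => if r = p then a else b)
  rw [LinkType.univ_eq_pair hpq, Finset.prod_pair hpq, if_pos rfl, if_neg hpq.symm] at this
  rw [← LinkType.univ_eq_pair hpq] at this
  rw [← this]
  congr 2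
  ext ω
  simp only [Set.mem_preimage, Set.mem_prod, Set.mem_Ici, Set.mem_ofPred_eq]
  constructor
  · rintro ⟨h1, h2⟩ r
    split_ifs with hr
    · exact hr ▸ h1
    · have : r ∈ ({p, q} : Finset LinkType) := by
        rw [← LinkType.univ_eq_pair hpq]; exact Finset.mem_univ r
      rcases Finset.mem_insert.1 this with h' | h'
      · exact absurd h' hr
      · rw [Finset.mem_singleton.1 h']; exact h2
  · intro h'
    refine ⟨by simpa using h' p, by simpa [hpq.symm] using h' q⟩

end IsColocated

end NetworkParams

/-! ### Almost sure geometry of the sites. -/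

lemma poissonMeasure_Ici_one_le (v : NNReal) : poissonMeasure v (Set.Ici 1) ≤ v := by
  have h : (Set.Ici 1 : Set ℕ) = {0}ᶜ := by ext k; simp [Nat.one_le_iff_ne_zero]
  rw [h, prob_compl_eq_one_sub (measurableSet_singleton _), poissonMeasure_singleton,
    ← ENNReal.ofReal_one, ← ENNReal.ofReal_sub _ (by positivity), ← ENNReal.ofReal_coe_nnreal]
  refine ENNReal.ofReal_le_ofReal ?_
  have := Real.add_one_le_exp (-(v : ℝ))
  simp; linarith

/-- From `exp (-v) ≥ 1 - v` one gets `1 - (1 + v) * exp (-v) ≤ v ^ 2`. The second order in `v` makes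
coincidences vanish under subdivision. -/
lemma poissonMeasure_Ici_two_le (v : NNReal) : poissonMeasure v (Set.Ici 2) ≤ (v : ℝ≥0∞) ^ 2 := by
  have h : (Set.Ici 2 : Set ℕ) = ({0} ∪ {1})ᶜ := by
    ext k; simp only [Set.mem_Ici, Set.mem_compl_iff, Set.mem_union, Set.mem_singleton_iff]; omega
  rw [h, prob_compl_eq_one_sub (.of_discrete), measure_union (by simp) (.of_discrete),
    poissonMeasure_singleton, poissonMeasure_singleton,
    ← ENNReal.ofReal_add (by positivity) (by positivity),
    ← ENNReal.ofReal_one, ← ENNReal.ofReal_sub _ (by positivity), ← ENNReal.ofReal_coe_nnreal,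
    ← ENNReal.ofReal_pow v.coe_nonneg]
  refine ENNReal.ofReal_le_ofReal ?_
  have h1 := Real.add_one_le_exp (-(v : ℝ))
  have h2 := v.coe_nonneg
  simp only [pow_zero, Nat.factorial_zero, Nat.factorial_one, pow_one, Nat.cast_one, div_one, mul_one]
  nlinarith

namespace IsPoissonPointProcess

variable {Ω : Type*} [MeasurableSpace Ω] {μ : Measure Ω} {X : ℕ → Ω → Plane} {ν : Measure Plane}

lemma measure_siteCount_mem (hX : IsPoissonPointProcess μ X ν) {A : Set Plane}
    (hA : MeasurableSet A) (hν : ν A ≠ ∞) {B : Set ℝ≥0∞} (hB : MeasurableSet B) :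
    μ {ω | siteCount X A ω ∈ B}
      = poissonMeasure (ν A).toNNReal {k : ℕ | (k : ℝ≥0∞) ∈ B} := by
  rw [show {ω | siteCount X A ω ∈ B} = siteCount X A ⁻¹' B from rfl,
    ← Measure.map_apply (hX.measurable_siteCount hA) hB, hX.count_law A hA hν,
    Measure.map_apply (by fun_prop) hB]
  rfl

lemma finite_setOf_mem (hX : IsPoissonPointProcess μ X ν) {A : Set Plane}
    (hA : MeasurableSet A) (hν : ν A ≠ ∞) : ∀ᵐ ω ∂μ, {j | X j ω ∈ A}.Finite := by
  have h : μ {ω | siteCount X A ω ∈ ({∞} : Set ℝ≥0∞)} = 0 := by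
    rw [hX.measure_siteCount_mem hA hν (measurableSet_singleton _)]
    simp
  filter_upwards [measure_eq_zero_iff_ae_notMem.1 h] with ω hω
  have hne : ∑' j, A.indicator (1 : Plane → ℝ≥0∞) (X j ω) ≠ ∞ := fun h => hω h
  refine (ENNReal.finite_const_le_of_tsum_ne_top hne one_ne_zero).subset fun j hj => ?_
  have hj' : X j ω ∈ A := hj
  simp [hj']

lemma ae_forall_notMem (hX : IsPoissonPointProcess μ X ν) {A : Set Plane}
    (hA : MeasurableSet A) (hν : ν A = 0) : ∀ᵐ ω ∂μ, ∀ j, X j ω ∉ A := by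
  have h : μ {ω | siteCount X A ω ∈ Set.Ici 1} = 0 := by
    rw [hX.measure_siteCount_mem hA (by simp [hν]) measurableSet_Ici]
    refine le_antisymm ?_ zero_le
    refine (measure_mono fun k hk => ?_).trans ((poissonMeasure_Ici_one_le _).trans ?_)
    · simpa using hk
    · simp [hν]
  filter_upwards [measure_eq_zero_iff_ae_notMem.1 h] with ω hω j hj
  refine hω ?_
  have : A.indicator (1 : Plane → ℝ≥0∞) (X j ω) ≤ siteCount X A ω := ENNReal.le_tsum j
  simpa [hj] using this

/-- Two distinct indices in `A` force a count of at least two, even if the points coincide. -/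
lemma measure_exists_pair_le (hX : IsPoissonPointProcess μ X ν) {A : Set Plane}
    (hA : MeasurableSet A) (hν : ν A ≠ ∞) :
    μ {ω | ∃ i j, i ≠ j ∧ X i ω ∈ A ∧ X j ω ∈ A} ≤ ν A ^ 2 := by
  calc μ {ω | ∃ i j, i ≠ j ∧ X i ω ∈ A ∧ X j ω ∈ A}
      ≤ μ {ω | siteCount X A ω ∈ Set.Ici 2} := by
        refine measure_mono ?_
        rintro ω ⟨i, j, hij, hi, hj⟩
        have := ENNReal.sum_le_tsum (f := fun j => A.indicator (1 : Plane → ℝ≥0∞) (X j ω)) {i, j}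
        rw [Finset.sum_pair hij] at this
        simp only [hi, hj, Set.indicator_of_mem, Pi.one_apply, one_add_one_eq_two] at this
        exact this
    _ = poissonMeasure (ν A).toNNReal {k : ℕ | (k : ℝ≥0∞) ∈ Set.Ici 2} :=
        hX.measure_siteCount_mem hA hν measurableSet_Ici
    _ ≤ poissonMeasure (ν A).toNNReal (Set.Ici 2) := by
        refine measure_mono fun k hk => ?_
        have hk' : (2 : ℝ≥0∞) ≤ (k : ℝ≥0∞) := hk
        exact_mod_cast hk'
    _ ≤ ν A ^ 2 := by
        refine (poissonMeasure_Ici_two_le _).trans ?_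
        rw [ENNReal.coe_toNNReal hν]

end IsPoissonPointProcess

lemma volume_annulus {a b : ℝ} (ha : 0 ≤ a) (hab : a ≤ b) :
    volume (Metric.ball (0 : Plane) b \ Metric.ball 0 a)
      = ENNReal.ofReal (Real.pi * (b ^ 2 - a ^ 2)) := by
  rw [measure_sdiff (Metric.ball_subset_ball hab) measurableSet_ball.nullMeasurableSet
      (measure_ball_lt_top).ne, EuclideanSpace.volume_ball_fin_two,
    EuclideanSpace.volume_ball_fin_two, ← ENNReal.ofReal_pow ha, ← ENNReal.ofReal_pow (ha.trans hab),
    ← ENNReal.ofReal_mul (by positivity), ← ENNReal.ofReal_mul (by positivity),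
    ← ENNReal.ofReal_sub _ (by positivity)]
  congr 1; ring

section Homogeneous

variable {Ω : Type*} [MeasurableSpace Ω] {μ : Measure Ω} {X : ℕ → Ω → Plane} {lam : ℝ}

lemma ae_tendsto_norm (hX : IsPoissonPointProcess μ X (ENNReal.ofReal lam • volume)) :
    ∀ᵐ ω ∂μ, Filter.Tendsto (fun j => ‖X j ω‖) Filter.cofinite Filter.atTop := by
  have : ∀ K : ℕ, ∀ᵐ ω ∂μ, {j | X j ω ∈ Metric.ball 0 (K : ℝ)}.Finite := fun K =>
    hX.finite_setOf_mem measurableSet_ball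
      (ENNReal.mul_ne_top ENNReal.ofReal_ne_top measure_ball_lt_top.ne)
  filter_upwards [ae_all_iff.2 this] with ω hω
  rw [Filter.tendsto_atTop]
  intro b
  obtain ⟨K, hK⟩ := exists_nat_ge b
  refine (hω K).subset fun j hj => ?_
  simp only [Set.mem_compl_iff, Set.mem_ofPred_eq, not_le] at hj
  have hj' : ‖X j ω‖ < b := by simpa using hj
  simpa using hj'.trans_le hK

lemma ae_norm_pos (hX : IsPoissonPointProcess μ X (ENNReal.ofReal lam • volume)) :
    ∀ᵐ ω ∂μ, ∀ j, 0 < ‖X j ω‖ := by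
  filter_upwards [hX.ae_forall_notMem (measurableSet_singleton 0) (by simp)] with ω hω j
  exact norm_pos_iff.2 (hω j)

/-- A disc is cut into `m + 1` annuli of equal intensity `c / (m + 1)`. Two sites of equal norm
share an annulus, which has probability at most `(m + 1) * (c / (m + 1)) ^ 2 = c ^ 2 / (m + 1)`;
this tends to zero. -/
lemma ae_injective_norm (hX : IsPoissonPointProcess μ X (ENNReal.ofReal lam • volume)) :
    ∀ᵐ ω ∂μ, Function.Injective fun j => ‖X j ω‖ := by
  have hK : ∀ K : ℕ, μ {ω | ∃ i j, i ≠ j ∧ ‖X i ω‖ = ‖X j ω‖ ∧ ‖X i ω‖ < K + 1} = 0 := by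
    intro K
    set R : ℝ := K + 1
    have hR : 0 < R := by positivity
    set c : ℝ≥0∞ := ENNReal.ofReal lam * ENNReal.ofReal (Real.pi * R ^ 2)
    have hc : c ≠ ∞ := ENNReal.mul_ne_top ENNReal.ofReal_ne_top ENNReal.ofReal_ne_top
    have hbound : ∀ m : ℕ, μ {ω | ∃ i j, i ≠ j ∧ ‖X i ω‖ = ‖X j ω‖ ∧ ‖X i ω‖ < R}
        ≤ c ^ 2 / (m + 1 : ℕ) := by
      intro m
      -- Square roots make the squared radii equally spaced, hence the annuli of equal area.
      set r : ℕ → ℝ := fun k => √(k / (m + 1)) * R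
      set A : ℕ → Set Plane := fun k => Metric.ball 0 (r (k + 1)) \ Metric.ball 0 (r k)
      have hA : ∀ k, MeasurableSet (A k) := fun k => measurableSet_ball.diff measurableSet_ball
      have hr : ∀ k, r k ^ 2 = k / (m + 1) * R ^ 2 := fun k => by
        rw [mul_pow, Real.sq_sqrt (by positivity)]
      have hrmono : ∀ k, r k ≤ r (k + 1) := fun k => by
        simp only [r]; gcongr; simp
      have hνA : ∀ k, (ENNReal.ofReal lam • volume : Measure Plane) (A k) = c / (m + 1 : ℕ) := by
        intro k
        rw [Measure.smul_apply, volume_annulus (by positivity) (hrmono k), hr, hr, smul_eq_mul,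
          mul_div_assoc]
        congr 1
        rw [← ENNReal.ofReal_natCast, ← ENNReal.ofReal_div_of_pos (by positivity)]
        congr 1
        push_cast
        field_simp
        ring
      calc μ {ω | ∃ i j, i ≠ j ∧ ‖X i ω‖ = ‖X j ω‖ ∧ ‖X i ω‖ < R}
          ≤ μ (⋃ k ∈ Finset.range (m + 1), {ω | ∃ i j, i ≠ j ∧ X i ω ∈ A k ∧ X j ω ∈ A k}) := by
            refine measure_mono ?_
            rintro ω ⟨i, j, hij, hnorm, hlt⟩
            -- The integer part of `q` is the index of the annulus containing the points of this
            -- norm.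
            set q : ℝ := (m + 1) * (‖X i ω‖ / R) ^ 2
            have hq0 : 0 ≤ q := by positivity
            have hmem : ∀ x : Plane, ‖x‖ = ‖X i ω‖ → x ∈ A ⌊q⌋₊ := by
              intro x hx
              have hxq : ‖x‖ = √(q / (m + 1)) * R := by
                simp only [q]
                rw [mul_div_cancel_left₀ _ (by positivity), Real.sqrt_sq (by positivity), hx,
                  div_mul_cancel₀ _ hR.ne']
              have h1 := Nat.floor_le hq0
              have h2 := Nat.lt_floor_add_one q
              constructor
              · rw [mem_ball_zero_iff, hxq]
                simp only [r]
                gcongr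
                push_cast; exact h2
              · rw [mem_ball_zero_iff, hxq, not_lt]
                simp only [r]
                gcongr
            simp only [Set.mem_iUnion, Finset.mem_range]
            refine ⟨⌊q⌋₊, ?_, i, j, hij, hmem _ rfl, hmem _ hnorm.symm⟩
            rw [Nat.floor_lt hq0]
            have h3 : (‖X i ω‖ / R) ^ 2 < 1 := by
              have : ‖X i ω‖ / R < 1 := (div_lt_one hR).2 hlt
              have h0 : 0 ≤ ‖X i ω‖ / R := by positivity
              nlinarith
            push_cast
            simp only [q]
            have : (0 : ℝ) < m + 1 := by positivity
            nlinarith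
        _ ≤ ∑ k ∈ Finset.range (m + 1), μ {ω | ∃ i j, i ≠ j ∧ X i ω ∈ A k ∧ X j ω ∈ A k} :=
            measure_biUnion_finset_le _ _
        _ ≤ ∑ _k ∈ Finset.range (m + 1), (c / (m + 1 : ℕ)) ^ 2 := by
            refine Finset.sum_le_sum fun k _ => ?_
            rw [← hνA k]
            refine hX.measure_exists_pair_le (hA k) ?_
            rw [hνA k]
            exact ENNReal.div_ne_top hc (by simp)
        _ = c ^ 2 / (m + 1 : ℕ) := by
            rw [Finset.sum_const, Finset.card_range, nsmul_eq_mul, ENNReal.div_eq_inv_mul,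
              ENNReal.div_eq_inv_mul, mul_pow, sq (_ : ℝ≥0∞)⁻¹, ← mul_assoc, ← mul_assoc,
              ENNReal.mul_inv_cancel (by simp) (ENNReal.natCast_ne_top _), one_mul]
    have hlim : Filter.Tendsto (fun m : ℕ => c ^ 2 / ((m + 1 : ℕ) : ℝ≥0∞)) Filter.atTop (nhds 0) :=
      (ENNReal.Tendsto.const_div (ENNReal.tendsto_nat_nhds_top.comp (Filter.tendsto_add_atTop_nat 1))
        (Or.inr (ENNReal.pow_ne_top hc))).trans (by simp)
    exact le_antisymm (ge_of_tendsto' hlim hbound) zero_le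
  have h := fun K => measure_eq_zero_iff_ae_notMem.1 (hK K)
  filter_upwards [ae_all_iff.2 h] with ω hω i j hij
  by_contra hne
  obtain ⟨K, hKl⟩ := exists_nat_gt ‖X i ω‖
  exact hω K ⟨i, j, hne, hij, by linarith⟩

end Homogeneous

/-- The other link type. -/
def LinkType.other : LinkType → LinkType
  | .los => .nlos
  | .nlos => .los

lemma LinkType.ne_other (p : LinkType) : p ≠ p.other := by cases p <;> decide

lemma LinkType.eq_other_of_ne {p q : LinkType} (h : p ≠ q) : q = p.other := by
  cases p <;> cases q <;> first | exact absurd rfl h | rfl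

/-! ### Path loss and exclusion radius. -/

namespace NetworkParams

variable {M : ℕ} (N : NetworkParams M)

section Deterministic

lemma intensity_withDensity {γ : ℝ → ℝ} (hγ : Measurable γ) (p : LinkType) :
    (N.intensity p).withDensity (fun y => ENNReal.ofReal (γ y))
      = halfLineMeasure fun y => 2 * Real.pi * N.lam * N.linkProb p y * y * γ y := by
  have hpm := (N.continuous_linkProb p).measurable
  rw [intensity, halfLineMeasure, ← withDensity_mul _ (by fun_prop) (by fun_prop)]
  refine withDensity_congr_ae ?_
  filter_upwards [ae_restrict_mem measurableSet_Ioi] with y hy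
  have h1 := N.linkProb_nonneg p (le_of_lt hy)
  have h2 := N.lam_pos
  have h3 : (0 : ℝ) < y := hy
  rw [Pi.mul_apply, ← ENNReal.ofReal_mul (by positivity)]

/-- A factor bounded by one preserves local integrability of the radial intensity, so the primitive
argument applies to the weighted intensity as well. -/
lemma hasExpTail_intensity {γ : ℝ → ℝ} (hγ : Measurable γ) (hγ0 : ∀ y, 0 < y → 0 ≤ γ y)
    (hγ1 : ∀ y, 0 < y → γ y ≤ 1) (hγc : ContinuousOn γ (Set.Ioi 0)) (p : LinkType) :
    HasExpTail ((N.intensity p).withDensity fun y => ENNReal.ofReal (γ y)) := by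
  have hpm := (N.continuous_linkProb p).measurable
  have hpc := N.continuous_linkProb p
  have hlam := N.lam_pos
  rw [N.intensity_withDensity hγ]
  intro b hb
  refine setLIntegral_enegexp_halfLineMeasure ?_ ?_ (by fun_prop) (by fun_prop) hb
  · intro y hy
    have h1 := N.linkProb_nonneg p hy.le
    have := hγ0 y hy
    positivity
  · intro b
    refine Integrable.mul_bdd (c := 1) ?_ hγ.aestronglyMeasurable ?_
    · exact (Continuous.integrableOn_Icc (by fun_prop)).mono_set Set.Ioc_subset_Icc_self
    · filter_upwards [ae_restrict_mem measurableSet_Ioc] with z hz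
      rw [Real.norm_eq_abs, abs_of_nonneg (hγ0 z hz.1)]
      exact hγ1 z hz.1

lemma intensity_absolutelyContinuous (p : LinkType) :
    N.intensity p ≪ volume.restrict (Set.Ioi 0) :=
  withDensity_absolutelyContinuous _ _

lemma exclusionRadius_pos (s p : LinkType) {x : ℝ} (hx : 0 < x) : 0 < N.exclusionRadius s p x := by
  have := N.C_pos p
  have := N.C_pos s
  rw [exclusionRadius]; positivity

lemma exclusionRadius_self (p : LinkType) (x : ℝ) : N.exclusionRadius p p x = x := by
  rw [exclusionRadius, div_self (N.C_pos p).ne', div_self (N.alpha_pos p).ne', Real.one_rpow,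
    Real.rpow_one, one_mul]

lemma measurable_exclusionRadius (s p : LinkType) : Measurable (N.exclusionRadius s p) := by
  unfold exclusionRadius; fun_prop

lemma pathLoss_pos (p : LinkType) {x : ℝ} (hx : 0 < x) : 0 < N.pathLoss p x := by
  have := N.C_pos p
  rw [pathLoss]; positivity

lemma measurable_pathLoss (p : LinkType) : Measurable (N.pathLoss p) := by
  unfold pathLoss; fun_prop

/-- The defining property of the exclusion radius: it equalizes the two path losses. Comparisons of
received power become comparisons of distances by strict monotonicity. -/
lemma pathLoss_exclusionRadius (s p : LinkType) {x : ℝ} (hx : 0 < x) :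
    N.pathLoss p (N.exclusionRadius s p x) = N.pathLoss s x := by
  have hp := N.C_pos p
  have hs := N.C_pos s
  have ha := N.alpha_pos p
  have h1 : (0 : ℝ) ≤ (N.C p / N.C s) ^ (1 / N.alpha p) := by positivity
  have h2 : (0 : ℝ) ≤ x ^ (N.alpha s / N.alpha p) := by positivity
  rw [pathLoss, pathLoss, exclusionRadius, Real.mul_rpow h1 h2, ← Real.rpow_mul (by positivity),
    ← Real.rpow_mul hx.le]
  have e1 : 1 / N.alpha p * -N.alpha p = -1 := by field_simp
  have e2 : N.alpha s / N.alpha p * -N.alpha p = -N.alpha s := by field_simp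
  rw [e1, e2, Real.rpow_neg_one]
  field_simp

lemma pathLoss_strictAntiOn (p : LinkType) : StrictAntiOn (N.pathLoss p) (Set.Ioi 0) := by
  intro x hx y hy hxy
  exact mul_lt_mul_of_pos_left
    (Real.rpow_lt_rpow_of_neg hx hxy (neg_neg_of_pos (N.alpha_pos p))) (N.C_pos p)

lemma pathLoss_lt_iff (s p : LinkType) {x y : ℝ} (hx : 0 < x) (hy : 0 < y) :
    N.pathLoss p y < N.pathLoss s x ↔ N.exclusionRadius s p x < y := by
  rw [← N.pathLoss_exclusionRadius s p hx]
  exact (N.pathLoss_strictAntiOn p).lt_iff_gt hy (N.exclusionRadius_pos s p hx)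

lemma pathLoss_eq_iff (s p : LinkType) {x y : ℝ} (hx : 0 < x) (hy : 0 < y) :
    N.pathLoss p y = N.pathLoss s x ↔ y = N.exclusionRadius s p x := by
  rw [← N.pathLoss_exclusionRadius s p hx]
  exact (N.pathLoss_strictAntiOn p).injOn.eq_iff hy (N.exclusionRadius_pos s p hx)

end Deterministic

/-! ### Pathwise identification of the serving site. -/

section Pathwise

variable {Ω : Type*} {X : ℕ → Ω → Plane} {s : ℕ → Ω → LinkType} {n : Fin M} {ω : Ω}

/-- The properties of the sample configuration that hold almost surely. -/
structure IsRegular (X : ℕ → Ω → Plane) (s : ℕ → Ω → LinkType) (ω : Ω) : Prop where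
  tendsto_norm : Filter.Tendsto (fun j => ‖X j ω‖) Filter.cofinite Filter.atTop
  norm_pos : ∀ j, 0 < ‖X j ω‖
  injective_norm : Function.Injective fun j => ‖X j ω‖
  -- Excludes equal received power of the nearest sites of the two types.
  nearest_ne : ∀ p q, p ≠ q → nearest X s p ω ≠ ∞ →
    nearest X s q ω ≠ ENNReal.ofReal (N.exclusionRadius p q (nearest X s p ω).toReal)

variable {N}

lemma isServing_iff {i : ℕ} : N.IsServing X s n i ω ↔
    ∀ j, j ≠ i → N.pathLoss (s j ω) ‖X j ω‖ < N.pathLoss (s i ω) ‖X i ω‖ := by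
  refine forall_congr' fun j => imp_congr_right fun _ => ?_
  exact mul_lt_mul_iff_right₀ (N.P_pos n)

lemma IsServing.eq {i j : ℕ} (hi : N.IsServing X s n i ω) (hj : N.IsServing X s n j ω) : i = j := by
  by_contra hne
  exact lt_asymm (hi j (Ne.symm hne)) (hj i hne)

lemma IsServing.servingIndex_eq {i : ℕ} (hi : N.IsServing X s n i ω) :
    N.servingIndex X s n ω = i := by
  have : {k | N.IsServing X s n k ω} = {i} := by
    ext k; exact ⟨fun hk => IsServing.eq hk hi, fun hk => hk ▸ hi⟩
  rw [servingIndex, this, csInf_singleton]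

/-- A site that is strongest among the sites of its type is the nearest site of its type. -/
lemma nearest_eq_of_forall_le (hreg : N.IsRegular X s ω) {i : ℕ}
    (hi : ∀ j, s j ω = s i ω → N.pathLoss (s j ω) ‖X j ω‖ ≤ N.pathLoss (s i ω) ‖X i ω‖) :
    nearest X s (s i ω) ω = ‖X i ω‖ₑ := by
  refine le_antisymm ?_ (le_nearest_iff.2 fun j hj => ?_)
  · exact le_nearest_iff.1 le_rfl i rfl
  · have := hi j hj
    rw [hj, (N.pathLoss_strictAntiOn _).le_iff_ge (hreg.norm_pos j) (hreg.norm_pos i)] at this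
    rw [← ofReal_norm, ← ofReal_norm]
    exact ENNReal.ofReal_le_ofReal this

/-- Path losses tend to zero along the sites, so a maximum is attained. It is strict: a tie within a
type contradicts injectivity of the norms, and a tie across types contradicts `nearest_ne`. -/
lemma IsRegular.exists_isServing (hreg : N.IsRegular X s ω) (n : Fin M) :
    ∃ i, N.IsServing X s n i ω := by
  have hlim : Filter.Tendsto (fun j => N.pathLoss (s j ω) ‖X j ω‖) Filter.cofinite (nhds 0) := by
    have hp : ∀ p, Filter.Tendsto (fun j => N.pathLoss p ‖X j ω‖) Filter.cofinite (nhds 0) :=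
      fun p => by
        have := ((tendsto_rpow_neg_atTop (N.alpha_pos p)).comp hreg.tendsto_norm).const_mul (N.C p)
        rwa [mul_zero] at this
    have hsum := tendsto_finsetSum Finset.univ fun p _ => hp p
    rw [Finset.sum_const_zero] at hsum
    refine squeeze_zero (fun j => (N.pathLoss_pos _ (hreg.norm_pos j)).le) (fun j => ?_) hsum
    exact Finset.single_le_sum (f := fun p => N.pathLoss p ‖X j ω‖)
      (fun p _ => (N.pathLoss_pos p (hreg.norm_pos j)).le) (Finset.mem_univ (s j ω))
  -- Only the finitely many sites at least as strong as site `0` compete for the maximum.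
  have hfin : {j | N.pathLoss (s 0 ω) ‖X 0 ω‖ ≤ N.pathLoss (s j ω) ‖X j ω‖}.Finite := by
    have := hlim.eventually_lt_const (N.pathLoss_pos (s 0 ω) (hreg.norm_pos 0))
    refine Set.Finite.subset this fun j hj => ?_
    simpa using hj
  obtain ⟨i, hi, hmax⟩ := Set.exists_max_image _ (fun j => N.pathLoss (s j ω) ‖X j ω‖) hfin
    ⟨0, le_refl (N.pathLoss (s 0 ω) ‖X 0 ω‖)⟩
  have hmax' : ∀ j, N.pathLoss (s j ω) ‖X j ω‖ ≤ N.pathLoss (s i ω) ‖X i ω‖ := fun j => by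
    rcases le_total (N.pathLoss (s 0 ω) ‖X 0 ω‖) (N.pathLoss (s j ω) ‖X j ω‖) with h | h
    · exact hmax j h
    · exact h.trans hi
  refine ⟨i, isServing_iff.2 fun j hji => lt_of_le_of_ne (hmax' j) fun heq => ?_⟩
  by_cases hs : s i ω = s j ω
  · rw [← hs] at heq
    exact hji (hreg.injective_norm
      ((N.pathLoss_strictAntiOn _).injOn (hreg.norm_pos j) (hreg.norm_pos i) heq))
  · have hni := nearest_eq_of_forall_le hreg fun k (_ : s k ω = s i ω) => hmax' k
    have hnj := nearest_eq_of_forall_le hreg fun k (_ : s k ω = s j ω) => heq ▸ hmax' k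
    refine hreg.nearest_ne _ _ hs (by rw [hni]; simp) ?_
    rw [hni, hnj, toReal_enorm, ← ofReal_norm,
      (N.pathLoss_eq_iff _ _ (hreg.norm_pos i) (hreg.norm_pos j)).1 heq]

/-- Identification of the type and distance of the serving site through the nearest sites of the
two types. -/
lemma IsRegular.serving_iff (hreg : N.IsRegular X s ω) (n : Fin M) (p : LinkType) :
    N.servingType X s n ω = p ↔ nearest X s p ω ≠ ∞ ∧
      ENNReal.ofReal (N.exclusionRadius p p.other (nearest X s p ω).toReal)
        ≤ nearest X s p.other ω := by
  obtain ⟨i, hi⟩ := hreg.exists_isServing n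
  have hi' := isServing_iff.1 hi
  have hle : ∀ j, N.pathLoss (s j ω) ‖X j ω‖ ≤ N.pathLoss (s i ω) ‖X i ω‖ := fun j => by
    by_cases hj : j = i
    · rw [hj]
    · exact (hi' j hj).le
  have hni := nearest_eq_of_forall_le hreg fun k (_ : s k ω = s i ω) => hle k
  have hother : ∀ q, q ≠ s i ω →
      ENNReal.ofReal (N.exclusionRadius (s i ω) q ‖X i ω‖) ≤ nearest X s q ω := by
    intro q hq
    refine le_nearest_iff.2 fun j hj => ?_
    have hji : j ≠ i := fun h => hq (by rw [← hj, h])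
    have := (N.pathLoss_lt_iff _ _ (hreg.norm_pos i) (hreg.norm_pos j)).1 (hi' j hji)
    rw [← ofReal_norm, ← hj]
    exact ENNReal.ofReal_le_ofReal this.le
  rw [servingType, hi.servingIndex_eq]
  constructor
  · rintro rfl
    rw [hni, toReal_enorm]
    exact ⟨by simp, hother _ (LinkType.ne_other _).symm⟩
  · rintro ⟨hfin, h⟩
    -- If the other type served, the weak inequalities in both directions would give equal path
    -- losses, a tie that regularity excludes.
    by_contra hne
    have hso : s i ω = p.other := LinkType.eq_other_of_ne (Ne.symm hne)
    have h1 := hother p (Ne.symm hne)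
    rw [← hso, hni, ← ofReal_norm, ENNReal.ofReal_le_ofReal_iff (norm_nonneg _)] at h
    have hx := hreg.norm_pos i
    have hD := N.exclusionRadius_pos (s i ω) p hx
    have hr : N.exclusionRadius (s i ω) p ‖X i ω‖ ≤ (nearest X s p ω).toReal := by
      rwa [← ENNReal.ofReal_le_iff_le_toReal hfin]
    have hr0 := hD.trans_le hr
    have hDr := N.exclusionRadius_pos p (s i ω) hr0
    have hpl1 : N.pathLoss p (nearest X s p ω).toReal ≤ N.pathLoss (s i ω) ‖X i ω‖ := by
      rw [← N.pathLoss_exclusionRadius (s i ω) p hx]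
      exact (N.pathLoss_strictAntiOn p).antitoneOn hD hr0 hr
    have hpl2 : N.pathLoss (s i ω) ‖X i ω‖ ≤ N.pathLoss p (nearest X s p ω).toReal := by
      rw [← N.pathLoss_exclusionRadius p (s i ω) hr0]
      exact (N.pathLoss_strictAntiOn _).antitoneOn hDr hx h
    have heq := (N.pathLoss_eq_iff p (s i ω) hr0 hx).1 (le_antisymm hpl2 hpl1)
    refine hreg.nearest_ne p (s i ω) (Ne.symm hne) hfin ?_
    rw [hni, ← ofReal_norm, heq]

lemma IsRegular.servingDist_eq (hreg : N.IsRegular X s ω) (n : Fin M) :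
    N.servingDist X s n ω = (nearest X s (N.servingType X s n ω) ω).toReal := by
  obtain ⟨i, hi⟩ := hreg.exists_isServing n
  have hi' := isServing_iff.1 hi
  rw [servingDist, servingType, hi.servingIndex_eq, nearest_eq_of_forall_le hreg, toReal_enorm]
  intro j _
  by_cases hj : j = i
  · rw [hj]
  · exact (hi' j hj).le

lemma IsRegular.servingDist_pos (hreg : N.IsRegular X s ω) (n : Fin M) :
    0 < N.servingDist X s n ω := hreg.norm_pos _

end Pathwise

/-! ### Almost sure regularity and the weighted law of the serving site. -/

namespace IsColocated

variable {N} {Ω : Type*} [MeasurableSpace Ω] {μ : Measure Ω} {X : ℕ → Ω → Plane}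
  {s : ℕ → Ω → LinkType} {h θ : Fin M → ℕ → Ω → ℝ}

/-- For ties across types, the trivial weight `1` in `map_nearest` gives a product law of the two
nearest distances. Given the first, a tie fixes the second at one finite value, which has
probability zero. -/
lemma ae_isRegular [IsProbabilityMeasure μ] (hsys : N.IsColocated μ X s h θ) :
    ∀ᵐ ω ∂μ, N.IsRegular X s ω := by
  have hne : ∀ p q : LinkType, p ≠ q → ∀ᵐ ω ∂μ, nearest X s p ω ≠ ∞ →
      nearest X s q ω ≠ ENNReal.ofReal (N.exclusionRadius p q (nearest X s p ω).toReal) := by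
    intro p q hpq
    have htail : ∀ p, HasExpTail ((N.intensity p).withDensity fun _ => ENNReal.ofReal 1) := fun p =>
      N.hasExpTail_intensity (γ := fun _ => 1) measurable_const (by simp) (by simp)
        continuousOn_const p
    have hmap := hsys.map_nearest (g := fun _ _ => ENNReal.ofReal 1) (by fun_prop) (by simp) htail hpq
    have hone : weight X s (fun _ _ => ENNReal.ofReal 1) = 1 := by
      funext ω; simp [weight]
    rw [hone, withDensity_one] at hmap
    have := isProbabilityMeasure_minLaw (htail p)
    have := isProbabilityMeasure_minLaw (htail q)
    have hDm := N.measurable_exclusionRadius p q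
    set S : Set (ℝ≥0∞ × ℝ≥0∞) := {z | z.2 = ENNReal.ofReal (N.exclusionRadius p q z.1.toReal)}
    have hS : MeasurableSet S := measurableSet_eq_fun measurable_snd (by fun_prop)
    have hnull : ∀ᵐ z ∂(μ.map fun ω => (nearest X s p ω, nearest X s q ω)), z ∉ S := by
      rw [← measure_eq_zero_iff_ae_notMem, hmap, Measure.smul_apply, Measure.prod_apply hS,
        smul_eq_mul]
      refine mul_eq_zero_of_right _ ?_
      rw [lintegral_eq_zero_iff (measurable_measure_prodMk_left hS)]
      refine Filter.Eventually.of_forall fun a => ?_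
      exact minLaw_singleton (c := ENNReal.ofReal (N.exclusionRadius p q a.toReal))
        ((withDensity_absolutelyContinuous _ _).trans (N.intensity_absolutelyContinuous q))
        ENNReal.ofReal_ne_top
    filter_upwards [ae_of_ae_map ((hsys.measurable_nearest p).prodMk
      (hsys.measurable_nearest q)).aemeasurable hnull] with ω hω _
    exact hω
  filter_upwards [ae_tendsto_norm hsys.sites, ae_norm_pos hsys.sites, ae_injective_norm hsys.sites,
    hne _ _ (LinkType.ne_other .los), hne _ _ (LinkType.ne_other .nlos)] with ω h1 h2 h3 h4 h5
  refine ⟨h1, h2, h3, fun p q hpq => ?_⟩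
  rw [LinkType.eq_other_of_ne hpq]
  cases p
  · exact h4
  · exact h5

/-- The joint law of the type and distance of the serving site under the measure weighted by the
product of the factors `γ` of all sites. -/
theorem lintegral_serving_weight [IsProbabilityMeasure μ] (hsys : N.IsColocated μ X s h θ)
    (n : Fin M) {γ : LinkType → ℝ → ℝ} (hγ : ∀ p, Measurable (γ p))
    (hγ0 : ∀ p y, 0 < y → 0 ≤ γ p y) (hγ1 : ∀ p y, γ p y ≤ 1)
    (hγc : ∀ p, ContinuousOn (γ p) (Set.Ioi 0))
    {φ : LinkType → ℝ → ℝ≥0∞} (hφ : ∀ p, Measurable (φ p)) :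
    ∫⁻ ω, φ (N.servingType X s n ω) (N.servingDist X s n ω)
        * weight X s (fun p y => ENNReal.ofReal (γ p y)) ω ∂μ
      = enegexp (∑ r, ∫⁻ y, 1 - ENNReal.ofReal (γ r y) ∂N.intensity r) *
        ∑ p, ∫⁻ y, φ p y * ENNReal.ofReal (γ p y) *
          ∏ q, enegexp ((N.intensity q).withDensity (fun y => ENNReal.ofReal (γ q y))
            (Set.Iio (N.exclusionRadius p q y))) ∂N.intensity p := by
  set A := enegexp (∑ r, ∫⁻ y, 1 - ENNReal.ofReal (γ r y) ∂N.intensity r)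
  set g : LinkType → ℝ → ℝ≥0∞ := fun p y => ENNReal.ofReal (γ p y)
  have hg : ∀ p, Measurable (g p) := fun p => (hγ p).ennreal_ofReal
  have hg1 : ∀ p y, g p y ≤ 1 := fun p y => ENNReal.ofReal_le_one.2 (hγ1 p y)
  set ρ : LinkType → Measure ℝ := fun p => (N.intensity p).withDensity (g p)
  have htail : ∀ p, HasExpTail (ρ p) := fun p =>
    N.hasExpTail_intensity (hγ p) (hγ0 p) (fun y _ => hγ1 p y) (hγc p) p
  have hprob := fun p => isProbabilityMeasure_minLaw (htail p)
  have hDm := fun p q => N.measurable_exclusionRadius p q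
  -- The event that type `p` serves, written through the two nearest distances as in `serving_iff`.
  let Φ : LinkType → ℝ≥0∞ × ℝ≥0∞ → ℝ≥0∞ := fun p =>
    {z | z.1 ≠ ∞ ∧ ENNReal.ofReal (N.exclusionRadius p p.other z.1.toReal) ≤ z.2}.indicator
      fun z => φ p z.1.toReal
  have hΦset : ∀ p : LinkType, MeasurableSet {z : ℝ≥0∞ × ℝ≥0∞ | z.1 ≠ ∞ ∧
      ENNReal.ofReal (N.exclusionRadius p p.other z.1.toReal) ≤ z.2} := fun p => by
    refine MeasurableSet.inter ?_ (measurableSet_le ?_ measurable_snd)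
    · exact (measurable_fst (measurableSet_singleton ∞)).compl
    · have := hDm p p.other; fun_prop
  have hΦm : ∀ p, Measurable (Φ p) := fun p =>
    Measurable.indicator (by have := hφ p; fun_prop) (hΦset p)
  have hnm : ∀ p, Measurable fun ω => (nearest X s p ω, nearest X s p.other ω) := fun p =>
    (hsys.measurable_nearest p).prodMk (hsys.measurable_nearest p.other)
  have hwm : Measurable (weight X s g) := hsys.measurable_weight hg
  have hpt : ∀ᵐ ω ∂μ, φ (N.servingType X s n ω) (N.servingDist X s n ω) * weight X s g ω
      = ∑ p, weight X s g ω * Φ p (nearest X s p ω, nearest X s p.other ω) := by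
    filter_upwards [hsys.ae_isRegular] with ω hreg
    rw [Finset.sum_eq_single (N.servingType X s n ω)]
    · simp only [Φ]
      rw [Set.indicator_of_mem, hreg.servingDist_eq, mul_comm]
      exact (hreg.serving_iff n _).1 rfl
    · intro p _ hp
      simp only [Φ]
      rw [Set.indicator_of_notMem, mul_zero]
      exact fun hmem => hp ((hreg.serving_iff n p).2 hmem).symm
    · simp
  have hΦnm : ∀ p, Measurable fun ω => Φ p (nearest X s p ω, nearest X s p.other ω) := fun p =>
    (hΦm p).comp (hnm p)
  have hwΦm : ∀ p, Measurable fun ω =>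
      weight X s g ω * Φ p (nearest X s p ω, nearest X s p.other ω) := fun p => hwm.mul (hΦnm p)
  rw [lintegral_congr_ae hpt, lintegral_finsetSum _ fun p _ => hwΦm p,
    Finset.mul_sum]
  refine Finset.sum_congr rfl fun p _ => ?_
  have h1 : ∫⁻ ω, weight X s g ω * Φ p (nearest X s p ω, nearest X s p.other ω) ∂μ
      = ∫⁻ z, Φ p z ∂((μ.withDensity (weight X s g)).map
          fun ω => (nearest X s p ω, nearest X s p.other ω)) := by
    rw [lintegral_map (hΦm p) (hnm p),
      lintegral_withDensity_eq_lintegral_mul _ hwm (hΦnm p)]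
    rfl
  rw [h1, hsys.map_nearest hg hg1 htail p.ne_other, lintegral_smul_measure,
    lintegral_prod _ (hΦm p).aemeasurable, smul_eq_mul]
  congr 1
  -- Integrating out the nearest site of the other type leaves the probability that it lies beyond
  -- the exclusion radius.
  have hinner : ∀ a : ℝ≥0∞, ∫⁻ b, Φ p (a, b) ∂minLaw (ρ p.other)
      = ({∞}ᶜ : Set ℝ≥0∞).indicator (fun a => φ p a.toReal * minLaw (ρ p.other)
          (Set.Ici (ENNReal.ofReal (N.exclusionRadius p p.other a.toReal)))) a := by
    intro a
    by_cases ha : a = ∞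
    · simp [Φ, ha]
    · rw [Set.indicator_of_mem (by exact ha), ← setLIntegral_const, ← lintegral_indicator
        measurableSet_Ici]
      refine lintegral_congr fun b => ?_
      simp only [Φ]
      by_cases hb : ENNReal.ofReal (N.exclusionRadius p p.other a.toReal) ≤ b
      · rw [Set.indicator_of_mem (by exact ⟨ha, hb⟩), Set.indicator_of_mem (by exact hb)]
      · rw [Set.indicator_of_notMem (fun h => hb h.2), Set.indicator_of_notMem (by exact hb)]
  simp_rw [show ∀ p, (N.intensity p).withDensity (g p) = ρ p from fun _ => rfl, hinner]
  have hVm : Measurable fun a : ℝ≥0∞ => minLaw (ρ p.other)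
      (Set.Ici (ENNReal.ofReal (N.exclusionRadius p p.other a.toReal))) := by
    have h2 : Antitone fun c : ℝ≥0∞ => minLaw (ρ p.other) (Set.Ici c) := fun a b hab =>
      measure_mono (Set.Ici_subset_Ici.2 hab)
    have := hDm p p.other
    exact h2.measurable.comp (by fun_prop)
  rw [lintegral_minLaw (Measurable.indicator (by have := hφ p; fun_prop)
    (measurableSet_singleton _).compl) (by simp)]
  have hprodm : Measurable fun y => φ p y * ∏ q, enegexp (ρ q (Set.Iio (N.exclusionRadius p q y))) := by
    refine (hφ p).mul (Finset.measurable_prod _ fun q _ => ?_)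
    exact measurable_enegexp.comp ((measurable_measure_Iio (ρ q)).comp (hDm p q))
  have h3 : ∫⁻ y, φ p y * ∏ q, enegexp (ρ q (Set.Iio (N.exclusionRadius p q y))) ∂ρ p
      = ∫⁻ y, φ p y * ENNReal.ofReal (γ p y) *
        ∏ q, enegexp (ρ q (Set.Iio (N.exclusionRadius p q y))) ∂N.intensity p := by
    rw [lintegral_withDensity_eq_lintegral_mul _ (hg p) hprodm]
    refine lintegral_congr fun y => ?_
    simp only [Pi.mul_apply, g]
    ring
  rw [← h3]
  refine lintegral_congr_ae ?_
  have hac : ρ p ≪ volume.restrict (Set.Ioi 0) :=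
    (withDensity_absolutelyContinuous _ _).trans (N.intensity_absolutelyContinuous p)
  filter_upwards [hac.ae_le (ae_restrict_mem measurableSet_Ioi)] with y hy
  have hy0 : (0 : ℝ) < y := hy
  have hD := N.exclusionRadius_pos p p.other hy0
  -- Of the two void factors, the one for `p` is the density in `minLaw`, because the exclusion
  -- radius of the serving type is `y` itself; the other is the tail of the other type.
  rw [Set.indicator_of_mem (by simp), ENNReal.toReal_ofReal hy0.le, minLaw_Ici (htail p.other),
    ofReal_preimage_Iio_eq (by simpa using hD) ENNReal.ofReal_ne_top, ENNReal.toReal_ofReal hD.le,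
    LinkType.univ_eq_pair p.ne_other, Finset.prod_pair p.ne_other, exclusionRadius_self]
  ring

end IsColocated

end NetworkParams

namespace NetworkParams

variable {M : ℕ} {N : NetworkParams M}

namespace IsColocated

variable {Ω : Type*} [MeasurableSpace Ω] {μ : Measure Ω} {X : ℕ → Ω → Plane}
  {s : ℕ → Ω → LinkType} {h θ : Fin M → ℕ → Ω → ℝ}

/-- The conditional expectation, given the type and distance of the serving site, of a product of
factors over all sites. -/
theorem lintegral_serving_weight_eq [IsProbabilityMeasure μ] (hsys : N.IsColocated μ X s h θ)
    (n : Fin M) {γ : LinkType → ℝ → ℝ} (hγ : ∀ p, Measurable (γ p))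
    (hγ0 : ∀ p y, 0 < y → 0 ≤ γ p y) (hγ1 : ∀ p y, γ p y ≤ 1)
    (hγc : ∀ p, ContinuousOn (γ p) (Set.Ioi 0))
    {φ : LinkType → ℝ → ℝ≥0∞} (hφ : ∀ p, Measurable (φ p)) :
    ∫⁻ ω, φ (N.servingType X s n ω) (N.servingDist X s n ω)
        * weight X s (fun p y => ENNReal.ofReal (γ p y)) ω ∂μ
      = ∫⁻ ω, φ (N.servingType X s n ω) (N.servingDist X s n ω)
          * ENNReal.ofReal (γ (N.servingType X s n ω) (N.servingDist X s n ω))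
          * ∏ q, enegexp (∫⁻ z in Set.Ici
              (N.exclusionRadius (N.servingType X s n ω) q (N.servingDist X s n ω)),
              1 - ENNReal.ofReal (γ q z) ∂N.intensity q) ∂μ := by
  set g : LinkType → ℝ → ℝ≥0∞ := fun p y => ENNReal.ofReal (γ p y)
  have hg : ∀ p, Measurable (g p) := fun p => (hγ p).ennreal_ofReal
  have hg1 : ∀ p y, g p y ≤ 1 := fun p y => ENNReal.ofReal_le_one.2 (hγ1 p y)
  have hDm := fun p q => N.measurable_exclusionRadius p q
  set T : LinkType → ℝ → ℝ≥0∞ := fun q c => ∫⁻ z in Set.Ici c, 1 - g q z ∂N.intensity q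
  have hT : ∀ q, Measurable (T q) := fun q => Antitone.measurable fun a b hab =>
    lintegral_mono_set (Set.Ici_subset_Ici.2 hab)
  -- The test function multiplied by the conditional expectation to be proved; its unweighted
  -- integral is compared with the weighted integral of `φ`.
  set ψ : LinkType → ℝ → ℝ≥0∞ := fun p y =>
    φ p y * g p y * ∏ q, enegexp (T q (N.exclusionRadius p q y))
  have hψ : ∀ p, Measurable (ψ p) := fun p => by
    refine ((hφ p).mul (hg p)).mul (Finset.measurable_prod _ fun q _ => ?_)
    exact measurable_enegexp.comp ((hT q).comp (hDm p q))
  have h1 := hsys.lintegral_serving_weight n hγ hγ0 hγ1 hγc hφ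
  have h2 := hsys.lintegral_serving_weight n (γ := fun _ _ => 1) (fun _ => measurable_const)
    (by simp) (by simp) (fun _ => continuousOn_const) hψ
  have hone : ∀ ω, weight X s (fun _ _ => (1 : ℝ≥0∞)) ω = 1 := fun ω => by simp [weight]
  simp only [ENNReal.ofReal_one, hone, mul_one, tsub_self, lintegral_zero, Finset.sum_const_zero,
    enegexp_zero, one_mul] at h2
  rw [show (∫⁻ ω, φ (N.servingType X s n ω) (N.servingDist X s n ω) * weight X s g ω ∂μ) = _ from h1]
  refine Eq.trans ?_ h2.symm
  rw [Finset.mul_sum]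
  refine Finset.sum_congr rfl fun p _ => ?_
  rw [← lintegral_const_mul' _ _ (enegexp_ne_top _)]
  refine lintegral_congr fun y => ?_
  -- Splitting at the exclusion radius, the thinned void exponent below it and the part of `∫ (1 -
  -- g)` below it add up to the unthinned void exponent.
  have hq : ∀ q, enegexp (∫⁻ z, 1 - g q z ∂N.intensity q)
      * enegexp ((N.intensity q).withDensity (g q) (Set.Iio (N.exclusionRadius p q y)))
      = enegexp (T q (N.exclusionRadius p q y))
        * enegexp ((N.intensity q).withDensity (fun _ => 1) (Set.Iio (N.exclusionRadius p q y))) := by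
    intro q
    rw [← enegexp_add, ← enegexp_add]
    congr 1
    rw [← lintegral_add_compl (fun z => 1 - g q z)
      (measurableSet_Iio (a := N.exclusionRadius p q y)), Set.compl_Iio, add_comm _ (∫⁻ z in Set.Ici _, _ ∂_),
      add_assoc, withDensity_apply _ measurableSet_Iio, withDensity_apply _ measurableSet_Iio,
      ← lintegral_add_right _ (hg q)]
    congr 1
    exact lintegral_congr fun z => tsub_add_cancel_of_le (hg1 q z)
  simp only [ψ]
  rw [mul_left_comm, mul_assoc (φ p y * g p y), enegexp_sum, ← Finset.prod_mul_distrib,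
    ← Finset.prod_mul_distrib]
  congr 1
  exact Finset.prod_congr rfl fun q _ => hq q

end IsColocated

end NetworkParams

/-! ### Averaging over fadings and antenna angles. -/

/-- Tilting the rate `1` exponential density by `exp (-a * x)` gives `1 / (1 + a)` times the density
of rate `1 + a`. -/
lemma lintegral_exp_neg_expMeasure {a : ℝ} (ha : 0 ≤ a) :
    ∫⁻ x, ENNReal.ofReal (Real.exp (-(a * x))) ∂(expMeasure 1) = ENNReal.ofReal (1 / (1 + a)) := by
  have h1 : expMeasure 1 = volume.withDensity (exponentialPDF 1) := rfl
  have hm : Measurable (exponentialPDF 1) := (measurable_exponentialPDFReal 1).ennreal_ofReal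
  have hm' : Measurable (exponentialPDF (1 + a)) :=
    (measurable_exponentialPDFReal (1 + a)).ennreal_ofReal
  rw [h1, lintegral_withDensity_eq_lintegral_mul _ hm (by fun_prop)]
  have h2 : ∀ x, (exponentialPDF 1 * fun x => ENNReal.ofReal (Real.exp (-(a * x)))) x
      = ENNReal.ofReal (1 / (1 + a)) * exponentialPDF (1 + a) x := by
    intro x
    rw [Pi.mul_apply]
    rcases lt_or_ge x 0 with hx | hx
    · rw [exponentialPDF_of_neg hx, exponentialPDF_of_neg hx]; simp
    · rw [exponentialPDF_of_nonneg hx, exponentialPDF_of_nonneg hx,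
        ← ENNReal.ofReal_mul (by positivity), ← ENNReal.ofReal_mul (by positivity), one_mul,
        ← Real.exp_add]
      rw [← mul_assoc, one_div, inv_mul_cancel₀ (by positivity), one_mul, one_mul]
      congr 2; ring
  simp_rw [h2]
  rw [lintegral_const_mul _ hm', lintegral_exponentialPDF_eq_one (by positivity), mul_one]

/-- The joint law of independent random variables is the product law. -/
lemma lintegral_indepFun {Ω α β : Type*} [MeasurableSpace Ω] [MeasurableSpace α]
    [MeasurableSpace β] {μ : Measure Ω} [IsProbabilityMeasure μ] {U : Ω → α} {V : Ω → β}
    (hU : Measurable U) (hV : Measurable V) (hUV : IndepFun U V μ) {F : α → β → ℝ≥0∞}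
    (hF : Measurable (Function.uncurry F)) :
    ∫⁻ ω, F (U ω) (V ω) ∂μ = ∫⁻ ω, ∫⁻ ω', F (U ω) (V ω') ∂μ ∂μ := by
  have hmap := (indepFun_iff_map_prod_eq_prod_map_map hU.aemeasurable hV.aemeasurable).1 hUV
  have h1 := lintegral_map (μ := μ) hF (hU.prodMk hV)
  have := Measure.isProbabilityMeasure_map (μ := μ) hV.aemeasurable
  rw [hmap, lintegral_prod _ hF.aemeasurable, lintegral_map hF.lintegral_prod_right' hU] at h1
  refine Eq.trans h1.symm (lintegral_congr fun ω => ?_)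
  exact lintegral_map (f := fun b => F (U ω) b) (by fun_prop) hV

namespace NetworkParams

variable {M : ℕ} (N : NetworkParams M)

/-- The Laplace transform at `c` of the product of a fading and an antenna gain. -/
noncomputable def gainMixture (c : ℝ) : ℝ :=
  (N.thetab / Real.pi) / (1 + c * N.G1) + ((Real.pi - N.thetab) / Real.pi) / (1 + c * N.G2)

lemma measurable_gainMixture : Measurable N.gainMixture := by
  unfold gainMixture; fun_prop

/-- Strict positivity matters because the factor of the serving base station is divided out. For
zero beamwidth the first weight vanishes and the second is one. -/
lemma gainMixture_pos {c : ℝ} (hc : 0 ≤ c) : 0 < N.gainMixture c := by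
  have h1 := mul_nonneg hc N.G1_nonneg
  have h2 := mul_nonneg hc N.G2_nonneg
  have h3 := N.thetab_nonneg
  have h4 := sub_nonneg.2 N.thetab_le_pi
  have hpi := Real.pi_pos
  rw [gainMixture]
  rcases h3.lt_or_eq with h | h
  · have : 0 < N.thetab / Real.pi / (1 + c * N.G1) := by positivity
    have : 0 ≤ (Real.pi - N.thetab) / Real.pi / (1 + c * N.G2) := by positivity
    linarith
  · rw [← h]; simp only [zero_div, zero_add, sub_zero]; positivity

lemma gainMixture_le_one {c : ℝ} (hc : 0 ≤ c) : N.gainMixture c ≤ 1 := by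
  have h1 := mul_nonneg hc N.G1_nonneg
  have h2 := mul_nonneg hc N.G2_nonneg
  have h3 := N.thetab_nonneg
  have h4 := sub_nonneg.2 N.thetab_le_pi
  have hpi := Real.pi_pos
  have h5 : N.thetab / Real.pi / (1 + c * N.G1) ≤ N.thetab / Real.pi :=
    div_le_self (by positivity) (by linarith)
  have h6 : (Real.pi - N.thetab) / Real.pi / (1 + c * N.G2) ≤ (Real.pi - N.thetab) / Real.pi :=
    div_le_self (by positivity) (by linarith)
  have h7 : N.thetab / Real.pi + (Real.pi - N.thetab) / Real.pi = 1 := by field_simp; ring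
  rw [gainMixture]; linarith

lemma gainMixture_zero : N.gainMixture 0 = 1 := by
  have hpi := Real.pi_pos
  rw [gainMixture]; field_simp; ring

lemma continuousOn_gainMixture : ContinuousOn N.gainMixture (Set.Ici 0) := by
  have h1 : ∀ c ∈ Set.Ici (0 : ℝ), 1 + c * N.G1 ≠ 0 := fun c hc => by
    have := mul_nonneg hc N.G1_nonneg; linarith
  have h2 : ∀ c ∈ Set.Ici (0 : ℝ), 1 + c * N.G2 ≠ 0 := fun c hc => by
    have := mul_nonneg hc N.G2_nonneg; linarith
  unfold gainMixture
  exact (continuousOn_const.div (by fun_prop) h1).add (continuousOn_const.div (by fun_prop) h2)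

lemma gain_nonneg (x : ℝ) : 0 ≤ N.gain x := by
  rw [gain]; split_ifs
  exacts [N.G1_nonneg, N.G2_nonneg]

@[fun_prop]
lemma measurable_gain : Measurable N.gain :=
  Measurable.ite (measurableSet_lt (by fun_prop) measurable_const) measurable_const measurable_const

namespace IsColocated

variable {N} {Ω : Type*} [MeasurableSpace Ω] {μ : Measure Ω} {X : ℕ → Ω → Plane}
  {s : ℕ → Ω → LinkType} {h θ : Fin M → ℕ → Ω → ℝ}

lemma ae_fading_nonneg (hsys : N.IsColocated μ X s h θ) : ∀ᵐ ω ∂μ, ∀ m j, 0 ≤ h m j ω := by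
  refine ae_all_iff.2 fun m => ae_all_iff.2 fun j => ?_
  refine ae_of_ae_map (p := fun x => 0 ≤ x) (hsys.measurable_fading m j).aemeasurable ?_
  rw [hsys.fading_law m j, ae_iff]
  have h1 : expMeasure 1 = volume.withDensity (exponentialPDF 1) := rfl
  have hset : {x : ℝ | ¬ 0 ≤ x} = Set.Iio 0 := by ext; simp
  rw [hset, h1, withDensity_apply _ measurableSet_Iio]
  exact (setLIntegral_congr_fun measurableSet_Iio fun x hx => exponentialPDF_of_neg hx).trans
    (by simp)

lemma lintegral_gain [IsProbabilityMeasure μ] (hsys : N.IsColocated μ X s h θ) (m : Fin M) (j : ℕ)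
    (F : ℝ → ℝ≥0∞) :
    ∫⁻ ω, F (N.gain (θ m j ω)) ∂μ = F N.G1 * ENNReal.ofReal (N.thetab / Real.pi)
      + F N.G2 * ENNReal.ofReal ((Real.pi - N.thetab) / Real.pi) := by
  have hpi := Real.pi_pos
  have hle := N.thetab_le_pi
  set E : Set Ω := θ m j ⁻¹' Set.Ioo (-N.thetab) N.thetab
  have hE : MeasurableSet E := hsys.measurable_angle m j measurableSet_Ioo
  have hvol : volume (Set.Ioo (-Real.pi) Real.pi) = ENNReal.ofReal (2 * Real.pi) := by
    rw [Real.volume_Ioo]; congr 1; ring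
  have hμE : μ E = ENNReal.ofReal (N.thetab / Real.pi) := by
    rw [(hsys.angle_law m j).measure_preimage (by rw [hvol]; simpa using hpi) (by simp)
      measurableSet_Ioo, Set.inter_eq_self_of_subset_right
        (Set.Ioo_subset_Ioo (by linarith) hle), hvol, Real.volume_Ioo,
      ← ENNReal.ofReal_div_of_pos (by positivity)]
    congr 1; field_simp; ring
  have hμEc : μ Eᶜ = ENNReal.ofReal ((Real.pi - N.thetab) / Real.pi) := by
    rw [prob_compl_eq_one_sub hE, hμE, ← ENNReal.ofReal_one, ← ENNReal.ofReal_sub _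
      (div_nonneg N.thetab_nonneg hpi.le)]
    congr 1; field_simp
  rw [← lintegral_add_compl _ hE, ← hμE, ← hμEc, ← setLIntegral_const, ← setLIntegral_const]
  congr 1
  · refine setLIntegral_congr_fun hE fun ω hω => ?_
    simp only [gain]
    rw [if_pos (abs_lt.2 hω)]
  · refine setLIntegral_congr_fun hE.compl fun ω hω => ?_
    simp only [gain]
    rw [if_neg fun hlt => hω (abs_lt.1 hlt)]

/-- The joint Laplace transform of finitely many received powers. -/
lemma lintegral_prod_exp_fading_gain [IsProbabilityMeasure μ] (hsys : N.IsColocated μ X s h θ)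
    (F : Finset (Fin M × ℕ)) {c : Fin M × ℕ → ℝ} (hc : ∀ i, 0 ≤ c i) :
    ∫⁻ ω, ∏ i ∈ F, ENNReal.ofReal (Real.exp (-(c i * (h i.1 i.2 ω * N.gain (θ i.1 i.2 ω))))) ∂μ
      = ∏ i ∈ F, ENNReal.ofReal (N.gainMixture (c i)) := by
  have hhm : Measurable fun ω (i : Fin M × ℕ) => h i.1 i.2 ω :=
    measurable_pi_iff.2 fun i => hsys.measurable_fading i.1 i.2
  have hθm : Measurable fun ω (i : Fin M × ℕ) => θ i.1 i.2 ω :=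
    measurable_pi_iff.2 fun i => hsys.measurable_angle i.1 i.2
  have hFm : Measurable (Function.uncurry fun (b a : Fin M × ℕ → ℝ) =>
      ∏ i ∈ F, ENNReal.ofReal (Real.exp (-(c i * (a i * N.gain (b i)))))) := by
    refine Finset.measurable_prod _ fun i _ => ?_
    have := N.measurable_gain
    fun_prop
  -- The fadings are integrated first, with the angles frozen; the remaining factors are independent
  -- functions of the angles.
  rw [lintegral_indepFun hθm hhm hsys.fading_indep_angle.symm hFm]
  have hinner : ∀ ω, ∫⁻ ω', ∏ i ∈ F,
      ENNReal.ofReal (Real.exp (-(c i * (h i.1 i.2 ω' * N.gain (θ i.1 i.2 ω))))) ∂μ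
      = ∏ i ∈ F, ENNReal.ofReal (1 / (1 + c i * N.gain (θ i.1 i.2 ω))) := by
    intro ω
    rw [lintegral_prod_eq_prod_lintegral_of_indepFun F (fun i ω' =>
      ENNReal.ofReal (Real.exp (-(c i * (h i.1 i.2 ω' * N.gain (θ i.1 i.2 ω))))))]
    · refine Finset.prod_congr rfl fun i _ => ?_
      rw [← lintegral_exp_neg_expMeasure (mul_nonneg (hc i) (N.gain_nonneg _)),
        ← hsys.fading_law i.1 i.2, lintegral_map (by fun_prop) (hsys.measurable_fading i.1 i.2)]
      refine lintegral_congr fun ω' => ?_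
      congr 3; ring
    · exact hsys.fading_indep.comp (fun i x => ENNReal.ofReal (Real.exp (-(c i * (x *
        N.gain (θ i.1 i.2 ω)))))) fun i => by fun_prop
    · intro i
      have := hsys.measurable_fading i.1 i.2
      fun_prop
  simp_rw [hinner]
  rw [lintegral_prod_eq_prod_lintegral_of_indepFun F (fun i ω =>
      ENNReal.ofReal (1 / (1 + c i * N.gain (θ i.1 i.2 ω))))]
  · refine Finset.prod_congr rfl fun i _ => ?_
    have h1 := mul_nonneg (hc i) N.G1_nonneg
    have h2 := mul_nonneg (hc i) N.G2_nonneg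
    have h3 := N.thetab_nonneg
    have h4 := sub_nonneg.2 N.thetab_le_pi
    have hpi := Real.pi_pos
    rw [hsys.lintegral_gain i.1 i.2 fun G => ENNReal.ofReal (1 / (1 + c i * G)),
      ← ENNReal.ofReal_mul (by positivity), ← ENNReal.ofReal_mul (by positivity),
      ← ENNReal.ofReal_add (by positivity) (by positivity), gainMixture]
    congr 1; ring_nf
  · exact hsys.angle_indep.comp (fun i x => ENNReal.ofReal (1 / (1 + c i * N.gain x)))
      fun i => by have := N.measurable_gain; fun_prop
  · intro i
    have := hsys.measurable_angle i.1 i.2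
    have := N.measurable_gain
    fun_prop

/-- Integrating out finitely many fadings and antenna angles, with coefficients that depend on the
sites and link types. -/
lemma lintegral_mul_prod_exp [IsProbabilityMeasure μ] (hsys : N.IsColocated μ X s h θ)
    (F : Finset (Fin M × ℕ)) {c : Fin M × ℕ → (ℕ → Plane × LinkType) → ℝ}
    (hcm : ∀ i, Measurable (c i)) (hc : ∀ i z, 0 ≤ c i z)
    {φ : (ℕ → Plane × LinkType) → ℝ≥0∞} (hφ : Measurable φ) :
    ∫⁻ ω, φ (fun j => (X j ω, s j ω)) * ∏ i ∈ F, ENNReal.ofReal (Real.exp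
        (-(c i (fun j => (X j ω, s j ω)) * (h i.1 i.2 ω * N.gain (θ i.1 i.2 ω))))) ∂μ
      = ∫⁻ ω, φ (fun j => (X j ω, s j ω)) * ∏ i ∈ F, ENNReal.ofReal (N.gainMixture
          (c i fun j => (X j ω, s j ω))) ∂μ := by
  have hZm : Measurable fun ω (j : ℕ) => (X j ω, s j ω) :=
    measurable_pi_iff.2 fun j => (hsys.sites.measurable_point j).prodMk (hsys.measurable_type j)
  have hWm : Measurable fun ω (i : Fin M × ℕ) => (h i.1 i.2 ω, θ i.1 i.2 ω) :=
    measurable_pi_iff.2 fun i =>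
      (hsys.measurable_fading i.1 i.2).prodMk (hsys.measurable_angle i.1 i.2)
  have hFm : Measurable (Function.uncurry fun (z : ℕ → Plane × LinkType)
      (w : Fin M × ℕ → ℝ × ℝ) => φ z * ∏ i ∈ F,
        ENNReal.ofReal (Real.exp (-(c i z * ((w i).1 * N.gain (w i).2))))) := by
    refine (hφ.comp measurable_fst).mul (Finset.measurable_prod _ fun i _ => ?_)
    have := N.measurable_gain
    have := hcm i
    fun_prop
  rw [lintegral_indepFun hZm hWm hsys.sites_indep_marks hFm]
  refine lintegral_congr fun ω => ?_
  have hm : ∀ z, Measurable fun ω' => ∏ i ∈ F, ENNReal.ofReal (Real.exp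
      (-(c i z * (h i.1 i.2 ω' * N.gain (θ i.1 i.2 ω'))))) := fun z => by
    refine Finset.measurable_prod _ fun i _ => ?_
    have := hsys.measurable_angle i.1 i.2
    have := hsys.measurable_fading i.1 i.2
    have := N.measurable_gain
    fun_prop
  rw [lintegral_const_mul _ (hm _), hsys.lintegral_prod_exp_fading_gain F fun i => hc i _]

end IsColocated

end NetworkParams

/-! ### Measurability of the association and factors of the interferers. -/

namespace NetworkParams

variable {M : ℕ} {N : NetworkParams M}

lemma measurable_linkType_uncurry {α β Ω : Type*} [MeasurableSpace α] [MeasurableSpace β]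
    {_ : MeasurableSpace Ω} {g : LinkType → α → β} (hg : ∀ p, Measurable (g p)) {u : Ω → LinkType}
    {v : Ω → α} (hu : Measurable u) (hv : Measurable v) : Measurable fun ω => g (u ω) (v ω) := by
  have h1 : Measurable fun q : LinkType × α => g q.1 q.2 := measurable_from_prod_countable_right hg
  exact h1.comp (hu.prodMk hv)

section Measurability

variable {Ω : Type*} [MeasurableSpace Ω] {X : ℕ → Ω → Plane} {s : ℕ → Ω → LinkType}

lemma measurableSet_isServing (hX : ∀ j, Measurable (X j)) (hs : ∀ j, Measurable (s j))
    (n : Fin M) (i : ℕ) : MeasurableSet {ω | N.IsServing X s n i ω} := by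
  have hm : ∀ j, Measurable (N.avgPower X s n j) := fun j =>
    (measurable_linkType_uncurry (N.measurable_pathLoss) (hs j) (hX j).norm).const_mul _
  have : {ω | N.IsServing X s n i ω}
      = ⋂ j, ⋂ (_ : j ≠ i), {ω | N.avgPower X s n j ω < N.avgPower X s n i ω} := by
    ext ω; simp [IsServing]
  rw [this]
  exact MeasurableSet.iInter fun j => MeasurableSet.iInter fun _ => measurableSet_lt (hm j) (hm i)

lemma measurable_servingIndex (hX : ∀ j, Measurable (X j)) (hs : ∀ j, Measurable (s j))
    (n : Fin M) : Measurable (N.servingIndex X s n) := by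
  refine measurable_to_countable' fun k => ?_
  have hS := measurableSet_isServing (N := N) hX hs n
  have hnone : MeasurableSet {ω | ∀ i, ¬ N.IsServing X s n i ω} := by
    have : {ω | ∀ i, ¬ N.IsServing X s n i ω} = ⋂ i, {ω | N.IsServing X s n i ω}ᶜ := by ext; simp
    rw [this]
    exact MeasurableSet.iInter fun i => (hS i).compl
  -- The fibre over `0` also contains the configurations without a serving site, as the infimum of
  -- the empty set is `0`.
  have : N.servingIndex X s n ⁻¹' {k} = {ω | N.IsServing X s n k ω}
      ∪ ({ω | ∀ i, ¬ N.IsServing X s n i ω} ∩ {_ω | k = 0}) := by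
    ext ω
    simp only [Set.mem_preimage, Set.mem_singleton_iff, Set.mem_union, Set.mem_inter_iff,
      Set.mem_ofPred_eq]
    by_cases hex : ∃ i, N.IsServing X s n i ω
    · obtain ⟨i, hi⟩ := hex
      rw [hi.servingIndex_eq]
      constructor
      · rintro rfl; exact Or.inl hi
      · rintro (h | h)
        · exact hi.eq h
        · exact absurd hi (h.1 i)
    · push Not at hex
      have h0 : N.servingIndex X s n ω = 0 := by
        have : {i | N.IsServing X s n i ω} = ∅ := by
          ext i; simpa using hex i
        rw [servingIndex, this, Nat.sInf_empty]
      rw [h0]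
      constructor
      · intro h; exact Or.inr ⟨hex, h.symm⟩
      · rintro (h | h)
        · exact absurd h (hex k)
        · exact h.2.symm
  rw [this]
  exact (hS k).union (hnone.inter (.const _))

lemma measurable_apply_servingIndex {β : Type*} [MeasurableSpace β] {f : ℕ → Ω → β}
    (hf : ∀ j, Measurable (f j)) (hX : ∀ j, Measurable (X j)) (hs : ∀ j, Measurable (s j))
    (n : Fin M) : Measurable fun ω => f (N.servingIndex X s n ω) ω := by
  have h1 : Measurable fun q : ℕ × Ω => f q.1 q.2 := measurable_from_prod_countable_right hf
  exact h1.comp ((measurable_servingIndex hX hs n).prodMk measurable_id)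

lemma measurable_servingType (hX : ∀ j, Measurable (X j)) (hs : ∀ j, Measurable (s j))
    (n : Fin M) : Measurable (N.servingType X s n) :=
  measurable_apply_servingIndex hs hX hs n

lemma measurable_servingDist (hX : ∀ j, Measurable (X j)) (hs : ∀ j, Measurable (s j))
    (n : Fin M) : Measurable (N.servingDist X s n) :=
  measurable_apply_servingIndex (fun j => (hX j).norm) hX hs n

end Measurability

variable (N) in
/-- The coefficient of fading times antenna gain of operator `i.1` at site `i.2` in `t` times the
interference, as a function of the sites and link types. -/
noncomputable def interfererCoeff (t : ℝ) (Q : Finset (Fin M)) (n : Fin M) (i : Fin M × ℕ)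
    (z : ℕ → Plane × LinkType) : ℝ :=
  -- A zero coefficient yields the factor `1`, so one product over all operators and sites covers
  -- the serving site too. The serving index is computed from the coordinate projections, making the
  -- coefficient a function of the configuration alone.
  if i.1 ∈ Q ∧ ¬ (i.1 = n ∧ i.2 = N.servingIndex (fun j z => (z j).1) (fun j z => (z j).2) n z)
    then t * N.pathLoss (z i.2).2 ‖(z i.2).1‖ * N.P i.1 else 0

lemma pathLoss_nonneg (p : LinkType) {y : ℝ} (hy : 0 ≤ y) : 0 ≤ N.pathLoss p y := by
  have := N.C_pos p
  rw [pathLoss]; positivity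

lemma interfererCoeff_nonneg {t : ℝ} (ht : 0 ≤ t) (Q : Finset (Fin M)) (n : Fin M)
    (i : Fin M × ℕ) (z : ℕ → Plane × LinkType) : 0 ≤ N.interfererCoeff t Q n i z := by
  rw [interfererCoeff]
  split_ifs
  · exact mul_nonneg (mul_nonneg ht (pathLoss_nonneg _ (norm_nonneg _))) (N.P_pos _).le
  · exact le_rfl

lemma measurable_interfererCoeff (t : ℝ) (Q : Finset (Fin M)) (n : Fin M) (i : Fin M × ℕ) :
    Measurable (N.interfererCoeff t Q n i) := by
  have hX : ∀ j, Measurable fun z : ℕ → Plane × LinkType => (z j).1 := fun j => by fun_prop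
  have hs : ∀ j, Measurable fun z : ℕ → Plane × LinkType => (z j).2 := fun j => by fun_prop
  refine Measurable.ite ?_ ?_ measurable_const
  · refine (MeasurableSet.const _).inter (MeasurableSet.compl ((MeasurableSet.const _).inter ?_))
    exact measurableSet_eq_fun measurable_const (measurable_servingIndex hX hs n)
  · exact ((measurable_linkType_uncurry N.measurable_pathLoss (hs i.2) (hX i.2).norm).const_mul
      t).mul_const _

lemma gainMixture_eq_mixture (t : ℝ) (p : LinkType) (m : Fin M) (y : ℝ) :
    N.gainMixture (t * N.pathLoss p y * N.P m) = N.mixture t p m y := by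
  rw [gainMixture, mixture, pathLoss]
  congr 3 <;> ring

lemma mixture_pos {t : ℝ} (ht : 0 ≤ t) (p : LinkType) (m : Fin M) {y : ℝ} (hy : 0 ≤ y) :
    0 < N.mixture t p m y := by
  rw [← gainMixture_eq_mixture]
  exact N.gainMixture_pos (mul_nonneg (mul_nonneg ht (pathLoss_nonneg p hy)) (N.P_pos m).le)

lemma mixture_le_one {t : ℝ} (ht : 0 ≤ t) (p : LinkType) (m : Fin M) {y : ℝ} (hy : 0 ≤ y) :
    N.mixture t p m y ≤ 1 := by
  rw [← gainMixture_eq_mixture]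
  exact N.gainMixture_le_one (mul_nonneg (mul_nonneg ht (pathLoss_nonneg p hy)) (N.P_pos m).le)

lemma measurable_mixture (t : ℝ) (p : LinkType) (m : Fin M) : Measurable (N.mixture t p m) := by
  unfold mixture; fun_prop

lemma continuousOn_mixture {t : ℝ} (ht : 0 ≤ t) (p : LinkType) (m : Fin M) :
    ContinuousOn (N.mixture t p m) (Set.Ioi 0) := by
  have h1 : ContinuousOn (fun y => t * N.pathLoss p y * N.P m) (Set.Ioi 0) := by
    unfold pathLoss
    have : ContinuousOn (fun y : ℝ => y ^ (-N.alpha p)) (Set.Ioi 0) := fun y hy =>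
      (Real.continuousAt_rpow_const y _ (Or.inl (ne_of_gt hy))).continuousWithinAt
    fun_prop
  have h2 := N.continuousOn_gainMixture.comp h1 fun y (hy : 0 < y) =>
    mul_nonneg (mul_nonneg ht (pathLoss_nonneg p hy.le)) (N.P_pos m).le
  refine h2.congr fun y _ => ?_
  exact (gainMixture_eq_mixture t p m y).symm

variable (N) in
/-- The factor of all interferers at a site of link type `p` at distance `|y|`. -/
noncomputable def siteFactor (t : ℝ) (Q : Finset (Fin M)) (p : LinkType) (y : ℝ) : ℝ :=
  ∏ m ∈ Q, N.mixture t p m |y|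

lemma siteFactor_of_nonneg (t : ℝ) (Q : Finset (Fin M)) (p : LinkType) {y : ℝ} (hy : 0 ≤ y) :
    N.siteFactor t Q p y = ∏ m ∈ Q, N.mixture t p m y := by
  rw [siteFactor, abs_of_nonneg hy]

lemma siteFactor_nonneg {t : ℝ} (ht : 0 ≤ t) (Q : Finset (Fin M)) (p : LinkType) (y : ℝ) :
    0 ≤ N.siteFactor t Q p y :=
  Finset.prod_nonneg fun m _ => (mixture_pos ht p m (abs_nonneg y)).le

/-- The absolute value in `siteFactor` extends the bound to negative arguments, as the weighted laws
require it on the whole line. -/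
lemma siteFactor_le_one {t : ℝ} (ht : 0 ≤ t) (Q : Finset (Fin M)) (p : LinkType) (y : ℝ) :
    N.siteFactor t Q p y ≤ 1 :=
  Finset.prod_le_one (fun m _ => (mixture_pos ht p m (abs_nonneg y)).le)
    fun m _ => mixture_le_one ht p m (abs_nonneg y)

lemma measurable_siteFactor (t : ℝ) (Q : Finset (Fin M)) (p : LinkType) :
    Measurable (N.siteFactor t Q p) := by
  refine Finset.measurable_prod _ fun m _ => ?_
  have := N.measurable_mixture t p m
  fun_prop

lemma continuousOn_siteFactor {t : ℝ} (ht : 0 ≤ t) (Q : Finset (Fin M)) (p : LinkType) :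
    ContinuousOn (N.siteFactor t Q p) (Set.Ioi 0) := by
  have h1 : ContinuousOn (fun y => ∏ m ∈ Q, N.mixture t p m y) (Set.Ioi 0) :=
    continuousOn_finsetProd _ fun m _ => continuousOn_mixture ht p m
  exact h1.congr fun y hy => siteFactor_of_nonneg t Q p (le_of_lt hy)

/-! ### Factorization of the interference along a configuration. -/

section Pathwise

variable {Ω : Type*} {X : ℕ → Ω → Plane} {s : ℕ → Ω → LinkType} {h θ : Fin M → ℕ → Ω → ℝ}
  {ω : Ω}

/-- The two parts of the interference merge into one series over sites, with the serving base
station given coefficient zero. Nonnegative fadings make `ENNReal.ofReal` additive over operators,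
so the exponential factors. -/
lemma enegexp_interference {t : ℝ} (ht : 0 ≤ t) (Q : Finset (Fin M)) (n : Fin M)
    (hh : ∀ m j, 0 ≤ h m j ω) :
    enegexp (ENNReal.ofReal t * N.interference X s h θ Q n ω)
      = ⨅ k, ∏ i ∈ Finset.univ ×ˢ Finset.range k, ENNReal.ofReal (Real.exp
        (-(N.interfererCoeff t Q n i (fun j => (X j ω, s j ω))
          * (h i.1 i.2 ω * N.gain (θ i.1 i.2 ω))))) := by
  set z : ℕ → Plane × LinkType := fun j => (X j ω, s j ω)
  set i₀ := N.servingIndex X s n ω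
  have hi₀ : N.servingIndex (fun j z => (z j).1) (fun j z => (z j).2) n z = i₀ := rfl
  have hterm : ∀ j, ENNReal.ofReal t * (if j = i₀ then
        ENNReal.ofReal (N.pathLoss (s i₀ ω) ‖X i₀ ω‖ *
          ∑ m ∈ Q.erase n, N.P m * h m i₀ ω * N.gain (θ m i₀ ω)) else
        ENNReal.ofReal (N.pathLoss (s j ω) ‖X j ω‖ * ∑ m ∈ Q, N.P m * h m j ω * N.gain (θ m j ω)))
      = ENNReal.ofReal (∑ m, N.interfererCoeff t Q n (m, j) z * (h m j ω * N.gain (θ m j ω))) := by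
    intro j
    have hsum : ∑ m, N.interfererCoeff t Q n (m, j) z * (h m j ω * N.gain (θ m j ω))
        = t * (N.pathLoss (s j ω) ‖X j ω‖ * ∑ m ∈ (if j = i₀ then Q.erase n else Q),
          N.P m * h m j ω * N.gain (θ m j ω)) := by
      rw [← Finset.sum_subset (Finset.subset_univ (if j = i₀ then Q.erase n else Q)),
        Finset.mul_sum, Finset.mul_sum]
      · refine Finset.sum_congr rfl fun m hm => ?_
        rw [interfererCoeff, if_pos]
        · simp only [z]; ring
        · rw [hi₀]
          split_ifs at hm with hj
          · exact ⟨Finset.mem_of_mem_erase hm, fun h' => Finset.ne_of_mem_erase hm h'.1⟩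
          · exact ⟨hm, fun h' => hj h'.2⟩
      · intro m _ hm
        rw [interfererCoeff, if_neg, zero_mul]
        rintro ⟨hmQ, hne⟩
        rw [hi₀] at hne
        split_ifs at hm with hj
        · exact hm (Finset.mem_erase.2 ⟨fun h' => hne ⟨h', hj⟩, hmQ⟩)
        · exact hm hmQ
    rw [hsum, ENNReal.ofReal_mul ht]
    split_ifs with hj
    · rw [hj]
    · rfl
  have hinterf : N.interference X s h θ Q n ω = ∑' j, if j = i₀ then
        ENNReal.ofReal (N.pathLoss (s i₀ ω) ‖X i₀ ω‖ *
          ∑ m ∈ Q.erase n, N.P m * h m i₀ ω * N.gain (θ m i₀ ω)) else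
        ENNReal.ofReal (N.pathLoss (s j ω) ‖X j ω‖ *
          ∑ m ∈ Q, N.P m * h m j ω * N.gain (θ m j ω)) := by
    rw [interference]
    conv_lhs =>
      rw [← tsum_ite_eq i₀ fun _ => ENNReal.ofReal (N.pathLoss (s i₀ ω) ‖X i₀ ω‖ *
          ∑ m ∈ Q.erase n, N.P m * h m i₀ ω * N.gain (θ m i₀ ω)), ← ENNReal.tsum_add]
    refine tsum_congr fun j => ?_
    by_cases hj : j = i₀
    · rw [if_pos hj, if_pos hj, if_pos hj, add_zero]
    · rw [if_neg hj, if_neg hj, if_neg hj, zero_add]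
  rw [hinterf, ← ENNReal.tsum_mul_left]
  simp_rw [hterm]
  rw [enegexp_tsum]
  refine iInf_congr fun k => ?_
  rw [Finset.prod_product_right]
  refine Finset.prod_congr rfl fun j _ => ?_
  have hnn : ∀ m, 0 ≤ N.interfererCoeff t Q n (m, j) z * (h m j ω * N.gain (θ m j ω)) := fun m =>
    mul_nonneg (interfererCoeff_nonneg ht _ _ _ _) (mul_nonneg (hh m j) (N.gain_nonneg _))
  rw [ENNReal.ofReal_sum_of_nonneg fun m _ => hnn m, enegexp_sum]
  exact Finset.prod_congr rfl fun m _ => enegexp_ofReal (hnn m)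

/-- Restoring the missing factor of the serving base station completes the product to one over all
sites and all of `Q`, which no longer depends on which site serves. -/
lemma iInf_prod_gainMixture {t : ℝ} (ht : 0 ≤ t) {Q : Finset (Fin M)} {n : Fin M} (hn : n ∈ Q) :
    ENNReal.ofReal (N.mixture t (N.servingType X s n ω) n (N.servingDist X s n ω)) *
      ⨅ k, ∏ i ∈ Finset.univ ×ˢ Finset.range k, ENNReal.ofReal
        (N.gainMixture (N.interfererCoeff t Q n i fun j => (X j ω, s j ω)))
      = weight X s (fun p y => ENNReal.ofReal (N.siteFactor t Q p y)) ω := by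
  set z : ℕ → Plane × LinkType := fun j => (X j ω, s j ω)
  set i₀ := N.servingIndex X s n ω
  have hi₀ : N.servingIndex (fun j z => (z j).1) (fun j z => (z j).2) n z = i₀ := rfl
  set f : ℕ → ℝ≥0∞ := fun j => ∏ m, ENNReal.ofReal (N.gainMixture (N.interfererCoeff t Q n (m, j) z))
  have hf1 : ∀ j, f j ≤ 1 := fun j => Finset.prod_le_one' fun m _ =>
    ENNReal.ofReal_le_one.2 (N.gainMixture_le_one (interfererCoeff_nonneg ht _ _ _ _))
  have hmix : ∀ m j, 0 ≤ N.mixture t (s j ω) m ‖X j ω‖ := fun m j =>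
    (mixture_pos ht _ m (norm_nonneg _)).le
  have hfj : ∀ j, f j = ∏ m ∈ (if j = i₀ then Q.erase n else Q),
      ENNReal.ofReal (N.mixture t (s j ω) m ‖X j ω‖) := by
    intro j
    simp only [f]
    rw [← Finset.prod_subset (Finset.subset_univ (if j = i₀ then Q.erase n else Q))]
    · refine Finset.prod_congr rfl fun m hm => ?_
      rw [interfererCoeff, if_pos, gainMixture_eq_mixture]
      rw [hi₀]
      split_ifs at hm with hj
      · exact ⟨Finset.mem_of_mem_erase hm, fun h' => Finset.ne_of_mem_erase hm h'.1⟩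
      · exact ⟨hm, fun h' => hj h'.2⟩
    · intro m _ hm
      rw [interfererCoeff, if_neg, gainMixture_zero, ENNReal.ofReal_one]
      rintro ⟨hmQ, hne⟩
      rw [hi₀] at hne
      split_ifs at hm with hj
      · exact hm (Finset.mem_erase.2 ⟨fun h' => hne ⟨h', hj⟩, hmQ⟩)
      · exact hm hmQ
  have hg : ∀ j, ENNReal.ofReal (N.siteFactor t Q (s j ω) ‖X j ω‖)
      = ∏ m ∈ Q, ENNReal.ofReal (N.mixture t (s j ω) m ‖X j ω‖) := fun j => by
    rw [siteFactor_of_nonneg _ _ _ (norm_nonneg _), ENNReal.ofReal_prod_of_nonneg fun m _ => hmix m j]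
  have hg1 : ∀ j, ENNReal.ofReal (N.siteFactor t Q (s j ω) ‖X j ω‖) ≤ 1 := fun j =>
    ENNReal.ofReal_le_one.2 (siteFactor_le_one ht _ _ _)
  simp_rw [Finset.prod_product_right]
  -- Both infima are started at length `i₀ + 1`, so that every partial product contains the serving
  -- site.
  rw [weight, ← (IsColocated.antitone_prod_range hf1).iInf_nat_add (i₀ + 1),
    ← (IsColocated.antitone_prod_range hg1).iInf_nat_add (i₀ + 1),
    ENNReal.mul_iInf_of_ne (by simpa [servingDist] using mixture_pos ht _ n (norm_nonneg _))
      ENNReal.ofReal_ne_top]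
  refine iInf_congr fun k => ?_
  have hmem : i₀ ∈ Finset.range (k + (i₀ + 1)) := Finset.mem_range.2 (by omega)
  rw [← Finset.mul_prod_erase _ _ hmem, ← Finset.mul_prod_erase _ _ hmem, ← mul_assoc]
  congr 1
  · rw [hg, hfj, if_pos rfl, ← Finset.mul_prod_erase Q _ hn]
    rfl
  · refine Finset.prod_congr rfl fun j hj => ?_
    rw [hg, hfj, if_neg (Finset.ne_of_mem_erase hj)]

end Pathwise

end NetworkParams

/-! ### The conditional Laplace transform of the interference. -/

namespace NetworkParams

variable {M : ℕ} {N : NetworkParams M}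

lemma lintegral_intensity_siteFactor {t : ℝ} (ht : 0 ≤ t) (Q : Finset (Fin M)) (p : LinkType)
    {D : ℝ} (hD : 0 ≤ D) :
    ∫⁻ y in Set.Ici D, 1 - ENNReal.ofReal (N.siteFactor t Q p y) ∂N.intensity p
      = ENNReal.ofReal (2 * Real.pi * N.lam) * ∫⁻ y in Set.Ioi D,
        ENNReal.ofReal (N.linkProb p y * (1 - ∏ m ∈ Q, N.mixture t p m y) * y) := by
  have hpm := (N.continuous_linkProb p).measurable
  have hsm := N.measurable_siteFactor t Q p
  have hlam := N.lam_pos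
  have hmm : Measurable fun y => ∏ m ∈ Q, N.mixture t p m y :=
    Finset.measurable_prod _ fun m _ => N.measurable_mixture t p m
  rw [intensity, setLIntegral_withDensity_eq_setLIntegral_mul _ (by fun_prop) (by fun_prop)
    measurableSet_Ici, Measure.restrict_restrict measurableSet_Ici,
    ← lintegral_const_mul _ (by fun_prop)]
  have hset : (Set.Ici D ∩ Set.Ioi 0 : Set ℝ) =ᵐ[volume] Set.Ioi D := by
    have h1 := (Ioi_ae_eq_Ici (a := D) (μ := volume)).symm.inter (ae_eq_refl (Set.Ioi (0 : ℝ)))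
    rwa [Set.Ioi_inter_Ioi, sup_eq_left.2 hD] at h1
  rw [setLIntegral_congr hset]
  refine setLIntegral_congr_fun measurableSet_Ioi fun y (hy : D < y) => ?_
  have hy0 : 0 < y := hD.trans_lt hy
  have h1 := N.linkProb_nonneg p hy0.le
  have h2 := siteFactor_nonneg (N := N) ht Q p y
  simp only [Pi.mul_apply]
  rw [← siteFactor_of_nonneg t Q p hy0.le, ← ENNReal.ofReal_one, ← ENNReal.ofReal_sub _ h2,
    ← ENNReal.ofReal_mul (by positivity), ← ENNReal.ofReal_mul (by positivity)]
  congr 1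
  ring

lemma expNeg_nonneg (u : ℝ≥0∞) : 0 ≤ expNeg u := by
  rw [expNeg_eq_toReal]; exact ENNReal.toReal_nonneg

lemma expNeg_le_one (u : ℝ≥0∞) : expNeg u ≤ 1 := by
  rw [expNeg_eq_toReal]
  exact ENNReal.toReal_le_of_le_ofReal zero_le_one (by simpa using enegexp_le_one u)

lemma laplaceFormula_nonneg {t : ℝ} (ht : 0 ≤ t) (Q : Finset (Fin M)) (n : Fin M) (p : LinkType)
    {x : ℝ} (hx : 0 ≤ x) : 0 ≤ N.laplaceFormula Q n t p x :=
  mul_nonneg (Finset.prod_nonneg fun m _ => (mixture_pos ht p m hx).le)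
    (Finset.prod_nonneg fun _ _ => expNeg_nonneg _)

lemma laplaceFormula_le_one {t : ℝ} (ht : 0 ≤ t) (Q : Finset (Fin M)) (n : Fin M) (p : LinkType)
    {x : ℝ} (hx : 0 ≤ x) : N.laplaceFormula Q n t p x ≤ 1 :=
  mul_le_one₀ (Finset.prod_le_one (fun m _ => (mixture_pos ht p m hx).le)
      fun m _ => mixture_le_one ht p m hx)
    (Finset.prod_nonneg fun _ _ => expNeg_nonneg _)
    (Finset.prod_le_one (fun _ _ => expNeg_nonneg _) fun _ _ => expNeg_le_one _)

lemma measurable_laplaceFormula (Q : Finset (Fin M)) (n : Fin M) (t : ℝ) (p : LinkType) :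
    Measurable (N.laplaceFormula Q n t p) := by
  refine (Finset.measurable_prod _ fun m _ => N.measurable_mixture t p m).mul
    (Finset.measurable_prod _ fun q _ => measurable_expNeg.comp (Measurable.const_mul ?_ _))
  have h1 : Measurable fun c : ℝ => ∫⁻ y in Set.Ioi c,
      ENNReal.ofReal (N.linkProb q y * (1 - ∏ m ∈ Q, N.mixture t q m y) * y) :=
    Antitone.measurable fun a b hab => lintegral_mono_set (Set.Ioi_subset_Ioi hab)
  exact h1.comp (N.measurable_exclusionRadius p q)

/-- The product over `Q.erase n` is the full site factor divided by the positive factor of operator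
`n`; this is the shape produced by the weighted law. -/
lemma ofReal_laplaceFormula {t : ℝ} (ht : 0 ≤ t) {Q : Finset (Fin M)} {n : Fin M} (hn : n ∈ Q)
    (p : LinkType) {x : ℝ} (hx : 0 < x) :
    ENNReal.ofReal (N.laplaceFormula Q n t p x)
      = (ENNReal.ofReal (N.mixture t p n x))⁻¹ * ENNReal.ofReal (N.siteFactor t Q p x) *
        ∏ q, enegexp (∫⁻ z in Set.Ici (N.exclusionRadius p q x),
          1 - ENNReal.ofReal (N.siteFactor t Q q z) ∂N.intensity q) := by
  have hmix := mixture_pos (N := N) ht p n hx.le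
  rw [laplaceFormula, ENNReal.ofReal_mul (Finset.prod_nonneg fun m _ => (mixture_pos ht p m hx.le).le),
    ENNReal.ofReal_prod_of_nonneg fun _ _ => expNeg_nonneg _]
  congr 1
  · rw [siteFactor_of_nonneg _ _ _ hx.le, ← Finset.mul_prod_erase Q _ hn,
      ENNReal.ofReal_mul hmix.le, ← mul_assoc,
      ENNReal.inv_mul_cancel (by simpa using hmix) ENNReal.ofReal_ne_top, one_mul]
  · refine Finset.prod_congr rfl fun q _ => ?_
    rw [ofReal_expNeg, lintegral_intensity_siteFactor ht Q q (N.exclusionRadius_pos p q hx).le]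

namespace IsColocated

variable {Ω : Type*} [MeasurableSpace Ω] {μ : Measure Ω} {X : ℕ → Ω → Plane}
  {s : ℕ → Ω → LinkType} {h θ : Fin M → ℕ → Ω → ℝ}

/-- Integrating out all fadings and antenna angles from the Laplace transform of the
interference. -/
lemma lintegral_mul_enegexp_interference [IsProbabilityMeasure μ] (hsys : N.IsColocated μ X s h θ)
    {n : Fin M} {Q : Finset (Fin M)} (hn : n ∈ Q) {t : ℝ} (ht : 0 ≤ t)
    {φ : (ℕ → Plane × LinkType) → ℝ≥0∞} (hφ : Measurable φ) (hφ1 : ∀ z, φ z ≤ 1) :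
    ∫⁻ ω, φ (fun j => (X j ω, s j ω))
        * enegexp (ENNReal.ofReal t * N.interference X s h θ Q n ω) ∂μ
      = ∫⁻ ω, φ (fun j => (X j ω, s j ω))
        * ((ENNReal.ofReal (N.mixture t (N.servingType X s n ω) n (N.servingDist X s n ω)))⁻¹
          * weight X s (fun p y => ENNReal.ofReal (N.siteFactor t Q p y)) ω) ∂μ := by
  have hZm : Measurable fun ω (j : ℕ) => (X j ω, s j ω) :=
    measurable_pi_iff.2 fun j => (hsys.sites.measurable_point j).prodMk (hsys.measurable_type j)
  have hφm : Measurable fun ω => φ fun j => (X j ω, s j ω) := hφ.comp hZm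
  have hφtop : ∀ z, φ z ≠ ∞ := fun z => ((hφ1 z).trans_lt ENNReal.one_lt_top).ne
  have hcm := measurable_interfererCoeff (N := N) t Q n
  have hc0 := interfererCoeff_nonneg (N := N) ht Q n
  have hcZ : ∀ i, Measurable fun ω => N.interfererCoeff t Q n i fun j => (X j ω, s j ω) :=
    fun i => (hcm i).comp hZm
  let F : ℕ → Finset (Fin M × ℕ) := fun k => Finset.univ ×ˢ Finset.range k
  have hFmono : ∀ {a : Fin M × ℕ → ℝ≥0∞}, (∀ i, a i ≤ 1) →
      Antitone fun k => ∏ i ∈ F k, a i := fun ha k l hkl =>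
    Finset.prod_le_prod_of_subset_of_le_one'
      (Finset.product_subset_product_right (Finset.range_mono hkl)) fun i _ _ => ha i
  -- Replacing the fading by its positive part changes nothing almost surely and makes every factor
  -- at most one everywhere, so partial products are antitone for all `ω`.
  set a : Fin M × ℕ → Ω → ℝ≥0∞ := fun i ω => ENNReal.ofReal (Real.exp
    (-(N.interfererCoeff t Q n i (fun j => (X j ω, s j ω)) * (max (h i.1 i.2 ω) 0 *
      N.gain (θ i.1 i.2 ω)))))
  set b : Fin M × ℕ → Ω → ℝ≥0∞ := fun i ω => ENNReal.ofReal
    (N.gainMixture (N.interfererCoeff t Q n i fun j => (X j ω, s j ω)))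
  have ham : ∀ i, Measurable (a i) := fun i => by
    have := hcZ i
    have := hsys.measurable_fading i.1 i.2
    have := hsys.measurable_angle i.1 i.2
    have := N.measurable_gain
    fun_prop
  have hbm : ∀ i, Measurable (b i) := fun i =>
    (N.measurable_gainMixture.comp (hcZ i)).ennreal_ofReal
  have ha1 : ∀ i ω, a i ω ≤ 1 := fun i ω => by
    rw [ENNReal.ofReal_le_one, Real.exp_le_one_iff, neg_nonpos]
    exact mul_nonneg (hc0 _ _) (mul_nonneg (le_max_right _ _) (N.gain_nonneg _))
  have hb1 : ∀ i ω, b i ω ≤ 1 := fun i ω =>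
    ENNReal.ofReal_le_one.2 (N.gainMixture_le_one (hc0 _ _))
  -- Reduction to finite products, where fadings and angles can be integrated out.
  have hlim : ∀ c : Fin M × ℕ → Ω → ℝ≥0∞, (∀ i, Measurable (c i)) → (∀ i ω, c i ω ≤ 1) →
      ∫⁻ ω, φ (fun j => (X j ω, s j ω)) * ⨅ k, ∏ i ∈ F k, c i ω ∂μ
        = ⨅ k, ∫⁻ ω, φ (fun j => (X j ω, s j ω)) * ∏ i ∈ F k, c i ω ∂μ := by
    intro c hcm hc1
    have hm : ∀ k, Measurable fun ω => φ (fun j => (X j ω, s j ω)) * ∏ i ∈ F k, c i ω := fun k =>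
      hφm.mul (Finset.measurable_prod _ fun i _ => hcm i)
    rw [← lintegral_iInf hm]
    · refine lintegral_congr fun ω => ?_
      rw [ENNReal.mul_iInf' (fun h' => absurd h' (hφtop _)) fun _ => ⟨0⟩]
    · exact fun k l hkl ω => mul_le_mul_right (hFmono (fun i => hc1 i ω) hkl) _
    · refine ne_top_of_le_ne_top ENNReal.one_ne_top ?_
      calc ∫⁻ ω, φ (fun j => (X j ω, s j ω)) * ∏ i ∈ F 0, c i ω ∂μ ≤ ∫⁻ _, 1 ∂μ :=
            lintegral_mono fun ω => mul_le_one' (hφ1 _) (Finset.prod_le_one' fun i _ => hc1 i ω)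
        _ = 1 := by simp
  have hleft : ∀ᵐ ω ∂μ, φ (fun j => (X j ω, s j ω))
        * enegexp (ENNReal.ofReal t * N.interference X s h θ Q n ω)
      = φ (fun j => (X j ω, s j ω)) * ⨅ k, ∏ i ∈ F k, a i ω := by
    filter_upwards [hsys.ae_fading_nonneg] with ω hω
    rw [enegexp_interference ht Q n hω]
    simp only [a, max_eq_left (hω _ _)]
    rfl
  have hright : ∀ ω, (ENNReal.ofReal
        (N.mixture t (N.servingType X s n ω) n (N.servingDist X s n ω)))⁻¹
        * weight X s (fun p y => ENNReal.ofReal (N.siteFactor t Q p y)) ω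
      = ⨅ k, ∏ i ∈ F k, b i ω := by
    intro ω
    have hmix := mixture_pos (N := N) ht (N.servingType X s n ω) n
      (show 0 ≤ N.servingDist X s n ω from norm_nonneg _)
    rw [← iInf_prod_gainMixture ht hn, ← mul_assoc,
      ENNReal.inv_mul_cancel (by simpa using hmix) ENNReal.ofReal_ne_top, one_mul]
  have hfin : ∀ k, ∫⁻ ω, φ (fun j => (X j ω, s j ω)) * ∏ i ∈ F k, a i ω ∂μ
      = ∫⁻ ω, φ (fun j => (X j ω, s j ω)) * ∏ i ∈ F k, b i ω ∂μ := by
    intro k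
    rw [← hsys.lintegral_mul_prod_exp (F k) hcm hc0 hφ]
    refine lintegral_congr_ae ?_
    filter_upwards [hsys.ae_fading_nonneg] with ω hω
    simp only [a, max_eq_left (hω _ _)]
  simp_rw [hright]
  rw [lintegral_congr_ae hleft, hlim a ham ha1, hlim b hbm hb1]
  exact iInf_congr hfin

/-- The conditional Laplace transform of the interference in integrated form. -/
theorem setLIntegral_enegexp_interference [IsProbabilityMeasure μ]
    (hsys : N.IsColocated μ X s h θ) {n : Fin M} {Q : Finset (Fin M)} (hn : n ∈ Q) {t : ℝ}
    (ht : 0 ≤ t) {B : Set (LinkType × ℝ)} (hB : MeasurableSet B) :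
    ∫⁻ ω in (fun ω => (N.servingType X s n ω, N.servingDist X s n ω)) ⁻¹' B,
        enegexp (ENNReal.ofReal t * N.interference X s h θ Q n ω) ∂μ
      = ∫⁻ ω in (fun ω => (N.servingType X s n ω, N.servingDist X s n ω)) ⁻¹' B,
        ENNReal.ofReal
          (N.laplaceFormula Q n t (N.servingType X s n ω) (N.servingDist X s n ω)) ∂μ := by
  have hX : ∀ j, Measurable fun z : ℕ → Plane × LinkType => (z j).1 := fun j => by fun_prop
  have hs : ∀ j, Measurable fun z : ℕ → Plane × LinkType => (z j).2 := fun j => by fun_prop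
  have hXΩ := hsys.sites.measurable_point
  have hsΩ := hsys.measurable_type
  have hSR : Measurable fun ω => (N.servingType X s n ω, N.servingDist X s n ω) :=
    (measurable_servingType hXΩ hsΩ n).prodMk (measurable_servingDist hXΩ hsΩ n)
  let χ : LinkType → ℝ → ℝ≥0∞ := fun p y => B.indicator 1 (p, y)
  have hχ : ∀ p, Measurable (χ p) := fun p =>
    (measurable_one.indicator hB).comp (measurable_prodMk_left)
  have hφ : Measurable fun z : ℕ → Plane × LinkType => χ
      (N.servingType (fun j z => (z j).1) (fun j z => (z j).2) n z)
      (N.servingDist (fun j z => (z j).1) (fun j z => (z j).2) n z) :=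
    measurable_linkType_uncurry hχ (measurable_servingType hX hs n) (measurable_servingDist hX hs n)
  have hχ1 : ∀ p y, χ p y ≤ 1 := fun p y => Set.indicator_le_self _ _ _
  have hset : ∀ f : Ω → ℝ≥0∞,
      ∫⁻ ω in (fun ω => (N.servingType X s n ω, N.servingDist X s n ω)) ⁻¹' B, f ω ∂μ
        = ∫⁻ ω, χ (N.servingType X s n ω) (N.servingDist X s n ω) * f ω ∂μ := by
    intro f
    rw [← lintegral_indicator (hSR hB)]
    refine lintegral_congr fun ω => ?_
    by_cases hω : (N.servingType X s n ω, N.servingDist X s n ω) ∈ B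
    · rw [Set.indicator_of_mem (by exact hω)]
      simp [χ, hω]
    · rw [Set.indicator_of_notMem (by exact hω)]
      simp [χ, hω]
  rw [hset, hset]
  have h1 := hsys.lintegral_mul_enegexp_interference hn ht hφ fun z => hχ1 _ _
  refine h1.trans ?_
  -- The inverse factor of the serving base station depends only on the serving type and distance,
  -- so it belongs to the test function.
  have h2 := hsys.lintegral_serving_weight_eq n (γ := N.siteFactor t Q)
    (measurable_siteFactor t Q) (fun p y _ => siteFactor_nonneg ht Q p y)
    (fun p y => siteFactor_le_one ht Q p y) (continuousOn_siteFactor ht Q)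
    (φ := fun p y => χ p y * (ENNReal.ofReal (N.mixture t p n y))⁻¹)
    fun p => (hχ p).mul (N.measurable_mixture t p n).ennreal_ofReal.inv
  simp_rw [← mul_assoc]
  refine h2.trans (lintegral_congr_ae ?_)
  filter_upwards [hsys.ae_isRegular] with ω hreg
  rw [ofReal_laplaceFormula ht hn _ (hreg.servingDist_pos n), mul_assoc, mul_assoc, mul_assoc]

lemma measurable_interference (hsys : N.IsColocated μ X s h θ) (Q : Finset (Fin M)) (n : Fin M) :
    Measurable (N.interference X s h θ Q n) := by
  have hX := hsys.sites.measurable_point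
  have hs := hsys.measurable_type
  have hidx : Measurable (N.servingIndex X s n) := measurable_servingIndex hX hs n
  have hpl : ∀ j, Measurable fun ω => N.pathLoss (s j ω) ‖X j ω‖ := fun j =>
    measurable_linkType_uncurry N.measurable_pathLoss (hs j) (hX j).norm
  have hg := N.measurable_gain
  have hpow : ∀ (Q' : Finset (Fin M)) j, Measurable fun ω =>
      ENNReal.ofReal (N.pathLoss (s j ω) ‖X j ω‖ * ∑ m ∈ Q', N.P m * h m j ω * N.gain (θ m j ω)) := by
    intro Q' j
    refine ((hpl j).mul (Finset.measurable_sum _ fun m _ => ?_)).ennreal_ofReal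
    have := hsys.measurable_fading m j
    have := hsys.measurable_angle m j
    fun_prop
  refine Measurable.add (measurable_apply_servingIndex (hpow (Q.erase n)) hX hs n)
    (Measurable.tsum fun j => Measurable.ite ?_ measurable_const (hpow Q j))
  exact measurableSet_eq_fun measurable_const hidx

end IsColocated

end NetworkParams

theorem lemma2 {M : ℕ} (N : NetworkParams M) (n : Fin M) (Q : Finset (Fin M)) (hn : n ∈ Q)
    {Ω : Type*} [MeasurableSpace Ω] (μ : MeasureTheory.Measure Ω)
    [MeasureTheory.IsProbabilityMeasure μ]
    (X : ℕ → Ω → Plane) (s : ℕ → Ω → LinkType) (h θ : Fin M → ℕ → Ω → ℝ)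
    (hsys : N.IsColocated μ X s h θ) :
    (∀ᵐ ω ∂μ, ∃! i, N.IsServing X s n i ω) ∧
    Measurable (fun ω => (N.servingType X s n ω, N.servingDist X s n ω)) ∧
    ∀ t : ℝ, 0 ≤ t →
      MeasureTheory.condExp
          (MeasurableSpace.comap
            (fun ω => (N.servingType X s n ω, N.servingDist X s n ω)) inferInstance)
          μ (fun ω => expNeg (ENNReal.ofReal t * N.interference X s h θ Q n ω))
        =ᵐ[μ] fun ω =>
          N.laplaceFormula Q n t (N.servingType X s n ω) (N.servingDist X s n ω) := by
  have hX := hsys.sites.measurable_point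
  have hs := hsys.measurable_type
  have hS : Measurable (N.servingType X s n) := NetworkParams.measurable_servingType hX hs n
  have hR : Measurable (N.servingDist X s n) := NetworkParams.measurable_servingDist hX hs n
  have hSR : Measurable fun ω => (N.servingType X s n ω, N.servingDist X s n ω) := hS.prodMk hR
  refine ⟨?_, hSR, fun t ht => ?_⟩
  · filter_upwards [hsys.ae_isRegular] with ω hreg
    obtain ⟨i, hi⟩ := hreg.exists_isServing n
    exact ⟨i, hi, fun j hj => hj.eq hi⟩
  have hI : Measurable fun ω => expNeg (ENNReal.ofReal t * N.interference X s h θ Q n ω) :=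
    measurable_expNeg.comp ((hsys.measurable_interference Q n).const_mul _)
  have hL0 : ∀ ω, 0 ≤ N.laplaceFormula Q n t (N.servingType X s n ω) (N.servingDist X s n ω) :=
    fun ω => NetworkParams.laplaceFormula_nonneg ht Q n _ (norm_nonneg _)
  have hL1 : ∀ ω, N.laplaceFormula Q n t (N.servingType X s n ω) (N.servingDist X s n ω) ≤ 1 :=
    fun ω => NetworkParams.laplaceFormula_le_one ht Q n _ (norm_nonneg _)
  have hLmΩ : Measurable fun ω =>
      N.laplaceFormula Q n t (N.servingType X s n ω) (N.servingDist X s n ω) :=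
    NetworkParams.measurable_linkType_uncurry (g := N.laplaceFormula Q n t)
      (NetworkParams.measurable_laplaceFormula Q n t) hS hR
  have hbdd : ∀ f : Ω → ℝ, Measurable f → (∀ ω, 0 ≤ f ω) → (∀ ω, f ω ≤ 1) → Integrable f μ :=
    fun f hf hf0 hf1 => Integrable.of_bound hf.aestronglyMeasurable 1
      (Filter.Eventually.of_forall fun ω => by rw [Real.norm_eq_abs, abs_of_nonneg (hf0 ω)]; exact hf1 ω)
  have hIi := hbdd _ hI (fun ω => NetworkParams.expNeg_nonneg _)
    fun ω => NetworkParams.expNeg_le_one _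
  have hLi := hbdd _ hLmΩ hL0 hL1
  symm
  -- Sets of the conditioning σ-algebra are preimages of measurable `B`, on which the integrated
  -- identity applies; boundedness by one gives integrability.
  refine ae_eq_condExp_of_forall_setIntegral_eq hSR.comap_le hIi (fun _ _ _ => hLi.integrableOn)
    ?_ ?_
  · rintro _ ⟨B, hB, rfl⟩ _
    rw [integral_eq_lintegral_of_nonneg_ae (Filter.Eventually.of_forall hL0)
        hLmΩ.aestronglyMeasurable,
      integral_eq_lintegral_of_nonneg_ae
        (Filter.Eventually.of_forall fun ω => NetworkParams.expNeg_nonneg _)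
        hI.aestronglyMeasurable]
    simp_rw [ofReal_expNeg]
    rw [hsys.setLIntegral_enegexp_interference hn ht hB]
  -- The formula must be measurable for the σ-algebra generated by the serving type and distance,
  -- not merely for the ambient one.
  · have hc := comap_measurable (m := inferInstanceAs (MeasurableSpace (LinkType × ℝ)))
      fun ω => (N.servingType X s n ω, N.servingDist X s n ω)
    have hm : Measurable[MeasurableSpace.comap
        (fun ω => (N.servingType X s n ω, N.servingDist X s n ω)) inferInstance]
        fun ω => N.laplaceFormula Q n t (N.servingType X s n ω) (N.servingDist X s n ω) :=
      NetworkParams.measurable_linkType_uncurry (g := N.laplaceFormula Q n t)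
        (NetworkParams.measurable_laplaceFormula Q n t) hc.fst hc.snd
    exact hm.stronglyMeasurable.aestronglyMeasurable
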